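/- Throughout, $\mathbb D$ is the open unit disk in $\mathbb C$. For a function $f$ on $\mathbb D$, $p>0$ and $0\le r<1$ put $M_p(r,f)=\big(\frac1{2\pi}\int_0^{2\pi}|f(re^{i\theta})|^p\,d\theta\big)^{1/p}$ and $\|f\|_p=\sup_{0\le r<1}M_p(r,f)$; $\mathbf h^p$ is the set of (real- or complex-valued) harmonic functions $f$ on $\mathbb D$ with $\|f\|_p<\infty$. For $K\ge 1$, a map $f:\mathbb D\to\mathbb C$ is harmonic $K$-quasiregular if it is harmonic, absolutely continuous on lines with locally square integrable partial derivatives, and, almost everywhere in $\mathbb D$, its Jacobian $J_f=|f_z|^2-|f_{\bar z}|^2$ is nonnegative and $(|f_z|+|f_{\bar z}|)^2\le K J_f$. For $w\neq 0$ let $\arg w\in(-\pi/2,3\pi/2]$, and for $p\ge 2$ let $D_p$ be the sector consisting of $0$ and all $w\in\mathbb C\setminus\{0\}$ with $$\arg w\in\Big[-\frac{(p-1)\pi}{2p},\frac{(3p-1)\pi}{2p}\Big].$$ **Theorem.** There are constants $C(K,p)$ and $c(K,p)$, depending only on $K\ge 1$ and $p\in[2,\infty)$, such that for every $p\in[2,\infty)$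 $$\lim_{K\to1^+}C(K,p)=\csc\frac{\pi}{2p},\qquad \lim_{K\to1^+}c(K,p)=\cot\frac{\pi}{2p},$$ and such that the following holds for all $K\ge 1$ and $p\in[2,\infty)$. Let $f=u+iv$ be a harmonic $K$-quasiregular mapping in $\mathbb D$ with $u\in\mathbf h^p$, and suppose that $$f(0)=0\quad\text{or}\quad \cos\big(p(\arg f(0)-\tfrac{\pi}{2})\big)\le 0 .$$ Assume moreover that either * $(\mathscr A_1)$ $p$ is an even integer, or * $(\mathscr A_2)$ $p$ is not an even integer and $f(\mathbb D)\subset D_p$. Then $f\in\mathbf h^p$, $v\in\mathbf h^p$, and $$\|f\|_p\le C(K,p)\,\|u\|_p,\qquad \|v\|_p\le c(K,p)\,\|u\|_p .$$ -/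

import Mathlib

open Real Set Filter Topology MeasureTheory

noncomputable section

namespace HarmonicQR

/-- The open unit disk. -/
def unitDisk : Set ℂ := Metric.ball (0 : ℂ) 1

/-- The partial derivative in the direction of the real axis. -/
def partialX (f : ℂ → ℂ) (z : ℂ) : ℂ := lineDeriv ℝ f z 1

/-- The partial derivative in the direction of the imaginary axis. -/
def partialY (f : ℂ → ℂ) (z : ℂ) : ℂ := lineDeriv ℝ f z Complex.I

/-- The Wirtinger derivative with respect to `z`. -/
def wirtinger (f : ℂ → ℂ) (z : ℂ) : ℂ :=
  (1 / 2) * (partialX f z - Complex.I * partialY f z)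

/-- The Wirtinger derivative with respect to the conjugate of `z`. -/
def wirtingerBar (f : ℂ → ℂ) (z : ℂ) : ℂ :=
  (1 / 2) * (partialX f z + Complex.I * partialY f z)

/-- The maximal directional derivative. -/
def maxDilation (f : ℂ → ℂ) (z : ℂ) : ℝ := ‖wirtinger f z‖ + ‖wirtingerBar f z‖

/-- The Jacobian. -/
def jacobian (f : ℂ → ℂ) (z : ℂ) : ℝ := ‖wirtinger f z‖ ^ 2 - ‖wirtingerBar f z‖ ^ 2

/-- Absolute continuity on lines: on every closed rectangle contained in `Ω`, the map is absolutely
continuous on almost every horizontal and almost every vertical segment. -/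
def IsACL (Ω : Set ℂ) (f : ℂ → ℂ) : Prop :=
  ∀ a b c d : ℝ, a < b → c < d → Icc a b ×ℂ Icc c d ⊆ Ω →
    (∀ᵐ y : ℝ, y ∈ Icc c d →
      AbsolutelyContinuousOnInterval (fun x : ℝ => f (x + y * Complex.I)) a b) ∧
    (∀ᵐ x : ℝ, x ∈ Icc a b →
      AbsolutelyContinuousOnInterval (fun y : ℝ => f (x + y * Complex.I)) c d)

/-- `ACL` maps whose partial derivatives are locally square integrable. -/
def IsACL2 (Ω : Set ℂ) (f : ℂ → ℂ) : Prop :=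
  IsACL Ω f ∧ ∀ s : Set ℂ, IsCompact s → s ⊆ Ω →
    MemLp (partialX f) 2 (volume.restrict s) ∧ MemLp (partialY f) 2 (volume.restrict s)

/-- `K`-quasiregular maps of `Ω`. -/
def IsQuasiregular (K : ℝ) (Ω : Set ℂ) (f : ℂ → ℂ) : Prop :=
  1 ≤ K ∧ IsACL2 Ω f ∧
    (∀ᵐ z ∂(volume.restrict Ω), 0 ≤ jacobian f z) ∧
    (∀ᵐ z ∂(volume.restrict Ω), maxDilation f z ^ 2 ≤ K * jacobian f z)

/-- Harmonic `K`-quasiregular maps of `Ω`. -/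
def IsHarmonicQuasiregular (K : ℝ) (Ω : Set ℂ) (f : ℂ → ℂ) : Prop :=
  InnerProductSpace.HarmonicOnNhd f Ω ∧ IsQuasiregular K Ω f

/-- The integral mean `M_p(r, f)` over the circle of radius `r` about the origin. -/
def integralMean {F : Type*} [NormedAddCommGroup F] (p r : ℝ) (f : ℂ → F) : ℝ :=
  (circleAverage (fun z => ‖f z‖ ^ p) 0 r) ^ (1 / p)

/-- The Hardy norm `sup_{0 ≤ r < 1} M_p(r, f)`; it is meaningful for members of the Hardy space. -/
def hardyNorm {F : Type*} [NormedAddCommGroup F] (p : ℝ) (f : ℂ → F) : ℝ :=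
  ⨆ r : Ico (0 : ℝ) 1, integralMean p r f

/-- The harmonic Hardy space: harmonic functions on the unit disk (their integral means exist by
continuity) with bounded integral means. -/
def MemHarmonicHardy {F : Type*} [NormedAddCommGroup F] [NormedSpace ℝ F]
    (p : ℝ) (f : ℂ → F) : Prop :=
  InnerProductSpace.HarmonicOnNhd f unitDisk ∧
    BddAbove (range fun r : Ico (0 : ℝ) 1 => integralMean p r f)

/-- The branch of the argument with values in `(-π/2, 3π/2]`, cut along the negative imaginary
axis. -/
def argBranch (w : ℂ) : ℝ := π / 2 + Complex.arg (-Complex.I * w)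

/-- The closed sector `D_p` (symmetric about the imaginary axis). -/
def sectorD (p : ℝ) : Set ℂ :=
  {w : ℂ | argBranch w ∈ Icc (-((p - 1) * π / (2 * p))) ((3 * p - 1) * π / (2 * p))}

/-- `p` is an even integer (used for `p ≥ 2`). -/
def IsEvenInteger (p : ℝ) : Prop := ∃ n : ℤ, Even n ∧ p = n

end HarmonicQR

end

/-! A harmonic `K`-quasiregular f satisfies |f_x² + f_y²| ≤ κ(|f_x|² + |f_y|²) with κ = (K² - 1)/(K²
+ 1). Hence if Ψ(w + η) - Ψ(w) is bounded above, up to o(|η|²), by Re(αη + βη²) - γ|η|² with κ|β| ≤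
γ, then the Laplacian of Ψ ∘ f is nonpositive in the viscosity sense. No smoothness of Ψ is needed,
and the circle averages of Ψ ∘ f are at most Ψ(f(0))
(`IsHarmonicQuasiregular.circleAverage_comp_le`).

The sharp constants come from Φ = `sharpFun p`, which is |w|^p cos(pθ) for θ ≤ π/p and -|w|^p
beyond, θ being the angle to the imaginary axis. Near each nonzero point of the first quadrant Φ is
touched from above by the real part of a constant times a branch of w^p; subtracting (p - 1)κ|w|^p
pays for the distortion (`hasSuperjet_sharpFun`). With a = π/(2p) and w = u + iv there are the
pointwise bounds |w|^p ≤ csc^p a |u|^p + cot a Φ(w) and |v|^p ≤ cot^p a |u|^p + B Φ(w)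
(`norm_rpow_le`, `abs_im_rpow_le`). The assumptions force Φ(f(0)) ≤ 0, so the average of Φ ∘ f is at
most ε = (p - 1)κ times the average of |f|^p. That term is absorbed when ε cot a < 1, and the
resulting factors tend to csc^p a and cot^p a as K → 1, since κ → 0.

When ε cot a ≥ 1 any finite constant suffices. It comes from the same super mean value inequality
applied to Burkholder's functions, integrated over the level
(`exists_circleAverage_abs_im_rpow_le`). -/

noncomputable section

/-! ### Second differences and the super mean value inequality. -/

namespace HarmonicQR

open InnerProductSpace Asymptotics

/-- The four point second difference of `f` at `z` with step `h`. -/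
def stencil {F : Type*} [AddCommGroup F] (f : ℂ → F) (z : ℂ) (h : ℝ) : F :=
  f (z + h) + f (z - h) + f (z + Complex.I * h) + f (z - Complex.I * h) - (4 : ℕ) • f z

theorem AnalyticAt.exists_isBigO_quadratic {F : ℂ → ℂ} {z : ℂ} (hF : AnalyticAt ℂ F z) :
    ∃ a b : ℂ, (fun y => F (z + y) - (F z + a * y + b * y ^ 2)) =O[𝓝 0] fun y => ‖y‖ ^ 3 := by
  obtain ⟨p, hp⟩ := hF
  refine ⟨p.coeff 1, p.coeff 2, ?_⟩
  refine (hp.isBigO_sub_partialSum_pow 3).congr_left fun y => ?_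
  have h0 : p.coeff 0 = F z := hp.coeff_zero _
  simp [FormalMultilinearSeries.partialSum, Finset.sum_range_succ, h0]
  ring

theorem tendsto_ofReal_mul (c : ℂ) : Tendsto (fun h : ℝ => c * (h : ℂ)) (𝓝 0) (𝓝 0) := by
  have : Continuous (fun h : ℝ => c * (h : ℂ)) := by fun_prop
  simpa using this.tendsto 0

/-- The directions 1, -1, i, -i have vanishing sum and vanishing sum of squares, so the linear and
quadratic Taylor terms cancel. -/
theorem AnalyticAt.stencil_isLittleO {F : ℂ → ℂ} {z : ℂ} (hF : AnalyticAt ℂ F z) :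
    (fun h : ℝ => stencil F z h) =o[𝓝 0] fun h => h ^ 2 := by
  obtain ⟨a, b, hab⟩ := AnalyticAt.exists_isBigO_quadratic hF
  have key : ∀ c : ℂ, (fun h : ℝ => F (z + c * h) - (F z + a * (c * h) + b * (c * h) ^ 2)) =O[𝓝 0]
      fun h => h ^ 3 := fun c => by
    refine (hab.comp_tendsto (tendsto_ofReal_mul c)).trans ?_
    refine IsBigO.of_bound (‖c‖ ^ 3) (Eventually.of_forall fun h => ?_)
    simp [mul_pow]
  have h3 : (fun h : ℝ => h ^ 3) =o[𝓝 0] fun h => h ^ 2 := by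
    simpa using isLittleO_pow_pow (𝕜 := ℝ) (show 2 < 3 by norm_num)
  refine IsBigO.trans_isLittleO ?_ h3
  refine ((((key 1).add (key (-1))).add (key Complex.I)).add (key (-Complex.I))).congr_left
    fun h => ?_
  simp only [stencil, sub_eq_add_neg, neg_mul, one_mul, mul_pow, neg_sq, Complex.I_sq]
  simp only [nsmul_eq_mul]
  push_cast
  ring

theorem HarmonicAt.stencil_isLittleO_real {f : ℂ → ℝ} {z : ℂ} (hf : HarmonicAt f z) :
    (fun h : ℝ => stencil f z h) =o[𝓝 0] fun h => h ^ 2 := by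
  obtain ⟨r, hr, hball⟩ := Metric.eventually_nhds_iff_ball.1 hf.eventually
  obtain ⟨F, hF, hFf⟩ := HarmonicOnNhd.exists_analyticOnNhd_ball_re_eq (z := z) (R := r) hball
  have h1 := AnalyticAt.stencil_isLittleO (hF z (Metric.mem_ball_self hr))
  have h2 : (fun h : ℝ => (stencil F z h).re) =o[𝓝 0] fun h => h ^ 2 :=
    (IsBigO.of_bound 1 (Eventually.of_forall fun h => by
      simpa using Complex.abs_re_le_norm (stencil F z h))).trans_isLittleO h1
  refine h2.congr' ?_ EventuallyEq.rfl
  have hev : ∀ c : ℂ, ∀ᶠ h : ℝ in 𝓝 0, z + c * h ∈ Metric.ball z r := fun c => by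
    have : Tendsto (fun h : ℝ => z + c * h) (𝓝 0) (𝓝 z) := by
      simpa using (tendsto_ofReal_mul c).const_add z
    exact this (Metric.ball_mem_nhds z hr)
  filter_upwards [hev 1, hev (-1), hev Complex.I, hev (-Complex.I)] with h h1 h2 h3 h4
  have e0 := hFf (Metric.mem_ball_self hr)
  have e1 := hFf h1
  have e2 := hFf h2
  have e3 := hFf h3
  have e4 := hFf h4
  simp only [neg_mul, one_mul, ← sub_eq_add_neg] at e0 e1 e2 e3 e4
  simp only [stencil, ← e0, ← e1, ← e2, ← e3, ← e4]
  simp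

theorem HarmonicAt.stencil_isLittleO {f : ℂ → ℂ} {z : ℂ} (hf : HarmonicAt f z) :
    (fun h : ℝ => stencil f z h) =o[𝓝 0] fun h => h ^ 2 := by
  have h1 := HarmonicAt.stencil_isLittleO_real (hf.comp_CLM Complex.reCLM)
  have h2 := HarmonicAt.stencil_isLittleO_real (hf.comp_CLM Complex.imCLM)
  have h3 : (fun h : ℝ => ‖stencil (Complex.reCLM ∘ f) z h‖ + ‖stencil (Complex.imCLM ∘ f) z h‖)
      =o[𝓝 0] fun h => h ^ 2 := h1.norm_left.add h2.norm_left
  refine (IsBigO.of_bound 1 (Eventually.of_forall fun h => ?_)).trans_isLittleO h3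
  have hre : stencil (Complex.reCLM ∘ f) z h = (stencil f z h).re := by simp [stencil]
  have him : stencil (Complex.imCLM ∘ f) z h = (stencil f z h).im := by simp [stencil]
  rw [hre, him, one_mul, Real.norm_of_nonneg (by positivity)]
  exact Complex.norm_le_abs_re_add_abs_im _

/-- Trigonometric polynomials are sums of a polynomial and a conjugate polynomial. -/
theorem exists_polynomial_of_mem_span_fourier {T : ℝ} [Fact (0 < T)] {g : C(AddCircle T, ℂ)}
    (hg : g ∈ Submodule.span ℂ (range (fourier (T := T)))) :
    ∃ q₁ q₂ : Polynomial ℂ, ∀ x, g x =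
      q₁.eval (x.toCircle : ℂ) + (starRingEnd ℂ) (q₂.eval (x.toCircle : ℂ)) := by
  induction hg using Submodule.span_induction with
  | mem g hg =>
    obtain ⟨n, rfl⟩ := hg
    rcases Int.eq_nat_or_neg n with ⟨m, rfl | rfl⟩
    · refine ⟨Polynomial.X ^ m, 0, fun x => ?_⟩
      simp [fourier_apply, AddCircle.toCircle_nsmul]
    · refine ⟨0, Polynomial.X ^ m, fun x => ?_⟩
      simp only [fourier_apply, neg_smul, natCast_zsmul, AddCircle.toCircle_neg,
        AddCircle.toCircle_nsmul, Circle.coe_inv_eq_conj, Circle.coe_pow, Polynomial.eval_zero,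
        Polynomial.eval_pow, Polynomial.eval_X, zero_add]
  | zero => exact ⟨0, 0, by simp⟩
  | add g₁ g₂ _ _ h₁ h₂ =>
    obtain ⟨a, b, hab⟩ := h₁
    obtain ⟨c, d, hcd⟩ := h₂
    refine ⟨a + c, b + d, fun x => ?_⟩
    simp [hab, hcd]
    ring
  | smul c g _ h =>
    obtain ⟨a, b, hab⟩ := h
    refine ⟨Polynomial.C c * a, Polynomial.C (starRingEnd ℂ c) * b, fun x => ?_⟩
    simp [hab]
    ring

/-- Density of trigonometric polynomials stands in for the Dirichlet problem: q₁ + conj q₂ has the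
same real part as q₁ + q₂, and the latter, taken at z / r, is entire. -/
theorem exists_analytic_re_near_on_sphere {U : ℂ → ℝ} {r : ℝ} (hr : 0 < r)
    (hU : ContinuousOn U (Metric.sphere 0 r)) {η : ℝ} (hη : 0 < η) :
    ∃ Q : ℂ → ℂ, AnalyticOnNhd ℂ Q univ ∧ ∀ z ∈ Metric.sphere (0 : ℂ) r, |(Q z).re - U z| ≤ η := by
  have : Fact (0 < 2 * π) := ⟨Real.two_pi_pos⟩
  have hmem : ∀ x : AddCircle (2 * π), (r : ℂ) * (x.toCircle : ℂ) ∈ Metric.sphere (0 : ℂ) r :=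
    fun x => by
      rw [mem_sphere_zero_iff_norm, norm_mul, Circle.norm_coe, Complex.norm_of_nonneg hr.le, mul_one]
  let g : C(AddCircle (2 * π), ℂ) :=
    ⟨fun x => (U (r * (x.toCircle : ℂ)) : ℂ), by
      refine Complex.continuous_ofReal.comp (hU.comp_continuous ?_ hmem)
      have := AddCircle.continuous_toCircle (T := 2 * π)
      fun_prop⟩
  have hg : g ∈ (Submodule.span ℂ (range (fourier (T := 2 * π)))).topologicalClosure := by
    rw [span_fourier_closure_eq_top]; trivial
  obtain ⟨g', hg', hdist⟩ := Metric.mem_closure_iff.1 hg η hη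
  obtain ⟨q₁, q₂, hq⟩ := exists_polynomial_of_mem_span_fourier hg'
  refine ⟨fun z => (q₁ + q₂).eval (z / r), fun z _ => ?_, fun z hz => ?_⟩
  · refine (Differentiable.analyticAt (f := fun z : ℂ => (q₁ + q₂).eval (z / r)) ?_ z)
    exact (q₁ + q₂).differentiable.comp (differentiable_id.div_const _)
  · set x : AddCircle (2 * π) := QuotientAddGroup.mk z.arg with hx
    have hzx : z = r * (x.toCircle : ℂ) := by
      have hz' : ‖z‖ = r := by simpa using hz
      have : (x.toCircle : ℂ) = Complex.exp (z.arg * Complex.I) := by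
        rw [hx, AddCircle.toCircle_apply_mk, Circle.coe_exp]
        congr 2
        field_simp
      rw [this, ← hz', Complex.norm_mul_exp_arg_mul_I]
    have hdx : ‖g x - g' x‖ ≤ η := by
      rw [← dist_eq_norm]
      exact (ContinuousMap.dist_apply_le_dist x).trans hdist.le
    have hgx : g x = (U z : ℂ) := by simp [g, ← hzx]
    have hzr : z / r = (x.toCircle : ℂ) := by
      rw [hzx, mul_div_cancel_left₀ _ (by exact_mod_cast hr.ne')]
    have hre : ((q₁ + q₂).eval (z / r)).re = (g' x).re := by
      rw [hzr, hq]; simp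
    rw [hre, abs_sub_comm]
    have := (Complex.abs_re_le_norm (g x - g' x)).trans hdx
    rwa [hgx, Complex.sub_re, Complex.ofReal_re] at this

/-- A continuous function whose second differences are nonpositive to second order satisfies the
super mean value inequality. -/
theorem circleAverage_le_of_stencil_le {U : ℂ → ℝ} {r : ℝ} (hr : 0 < r)
    (hU : ContinuousOn U (Metric.closedBall 0 r))
    (hS : ∀ z ∈ Metric.ball (0 : ℂ) r, ∀ e > 0, ∀ᶠ h : ℝ in 𝓝[>] 0, stencil U z h ≤ e * h ^ 2) :
    circleAverage U 0 r ≤ U 0 := by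
  refine le_of_forall_pos_le_add fun ε hε => ?_
  -- The error η is spent twice on replacing U by Re Q, and r² times on the penalty η‖z‖².
  set η : ℝ := ε / (2 + r ^ 2) with hη_def
  have hη : 0 < η := by positivity
  obtain ⟨Q, hQ, hQU⟩ := exists_analytic_re_near_on_sphere hr
    (hU.mono Metric.sphere_subset_closedBall) hη
  have hQc : Continuous Q := continuous_iff_continuousAt.2 fun z => (hQ z trivial).continuousAt
  -- The penalty contributes -4ηh² to the second difference, against at most ηh² each from U and Q.
  -- So the minimum of V cannot be interior.
  let V : ℂ → ℝ := fun z => U z - (Q z).re - η * ‖z‖ ^ 2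
  have hV : ContinuousOn V (Metric.closedBall 0 r) := by
    refine (hU.sub ?_).sub ?_ <;> apply Continuous.continuousOn <;> fun_prop
  obtain ⟨z₀, hz₀, hmin⟩ := (isCompact_closedBall (0 : ℂ) r).exists_isMinOn
    ⟨0, Metric.mem_closedBall_self hr.le⟩ hV
  have hsph : z₀ ∈ Metric.sphere (0 : ℂ) r := by
    by_contra hns
    have hb : z₀ ∈ Metric.ball (0 : ℂ) r := by
      rw [← Metric.closedBall_sdiff_sphere]; exact ⟨hz₀, hns⟩
    have hev : ∀ c : ℂ, ∀ᶠ h : ℝ in 𝓝 0, V z₀ ≤ V (z₀ + c * h) := fun c => by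
      have : Tendsto (fun h : ℝ => z₀ + c * h) (𝓝 0) (𝓝 z₀) := by
        simpa using (tendsto_ofReal_mul c).const_add z₀
      filter_upwards [this (Metric.isOpen_ball.mem_nhds hb)] with h hh
      exact hmin (Metric.ball_subset_closedBall hh)
    have hQs := (AnalyticAt.stencil_isLittleO (hQ z₀ trivial)).bound hη
    have hfalse : ∀ᶠ h : ℝ in 𝓝[>] 0, False := by
      filter_upwards [hS z₀ hb η hη, nhdsWithin_le_nhds (hev 1), nhdsWithin_le_nhds (hev (-1)),
        nhdsWithin_le_nhds (hev Complex.I), nhdsWithin_le_nhds (hev (-Complex.I)),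
        nhdsWithin_le_nhds hQs, self_mem_nhdsWithin] with h hs h1 h2 h3 h4 hq hpos
      have hpos : 0 < h := hpos
      simp only [neg_mul, one_mul, ← sub_eq_add_neg, V] at h1 h2 h3 h4
      have hq' : -(η * h ^ 2) ≤ (stencil Q z₀ h).re := by
        have := (Complex.abs_re_le_norm _).trans hq
        rw [Real.norm_of_nonneg (by positivity)] at this
        exact (abs_le.1 this).1
      have hn : ‖z₀ + h‖ ^ 2 + ‖z₀ - h‖ ^ 2 + ‖z₀ + Complex.I * h‖ ^ 2 + ‖z₀ - Complex.I * h‖ ^ 2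
          = 4 * ‖z₀‖ ^ 2 + 4 * h ^ 2 := by
        simp only [← Complex.normSq_eq_norm_sq, Complex.normSq_apply]
        simp
        ring
      simp only [stencil, Complex.sub_re, Complex.add_re, nsmul_eq_mul, Nat.cast_ofNat] at hs hq'
      simp only [Complex.mul_re, Complex.re_ofNat, Complex.im_ofNat, zero_mul, sub_zero] at hq'
      have : 0 < η * h ^ 2 := by positivity
      nlinarith
    exact (hfalse.exists).elim fun _ h => h
  have hV0 : V z₀ ≤ V 0 := hmin (Metric.mem_closedBall_self hr.le)
  have hz₀r : ‖z₀‖ = r := by simpa using hsph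
  have h1 : (Q 0).re ≤ U 0 + η + η * r ^ 2 := by
    have := (abs_le.1 (hQU z₀ hsph)).2
    simp only [V, hz₀r, norm_zero] at hV0
    nlinarith
  have hQh : HarmonicOnNhd (fun z => (Q z).re) (Metric.closedBall 0 |r|) :=
    fun z _ => AnalyticAt.harmonicAt_re (hQ z trivial)
  have hav : circleAverage (fun z => (Q z).re) 0 r = (Q 0).re :=
    InnerProductSpace.HarmonicOnNhd.circleAverage_eq hQh
  have hUi : CircleIntegrable U 0 r :=
    (hU.mono Metric.sphere_subset_closedBall).circleIntegrable hr.le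
  have hQi : CircleIntegrable (fun z => (Q z).re) 0 r :=
    (Complex.continuous_re.comp hQc).continuousOn.circleIntegrable hr.le
  have h2 : circleAverage U 0 r ≤ (Q 0).re + η := by
    have h3 : circleAverage U 0 r ≤ circleAverage (fun z => (Q z).re + η) 0 r := by
      refine circleAverage_mono hUi (hQi.add (circleIntegrable_const _ _ _)) fun z hz => ?_
      rw [abs_of_pos hr] at hz
      have := (abs_le.1 (hQU z hz)).1
      linarith
    rwa [circleAverage_fun_add hQi (circleIntegrable_const _ _ _), hav, circleAverage_const] at h3
  have : η * (2 + r ^ 2) = ε := by rw [hη_def]; field_simp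
  linarith

end HarmonicQR

end

/-! ### Superjets and composition with harmonic quasiregular maps. -/

noncomputable section

namespace HarmonicQR

open InnerProductSpace Asymptotics

/-- `Ψ` is touched from above at `w`, up to second order, by a quadratic function whose pullback
under a map of distortion `κ` is superharmonic. -/
def HasSuperjet (κ : ℝ) (Ψ : ℂ → ℝ) (w : ℂ) : Prop :=
  ∃ α β : ℂ, ∃ γ : ℝ, κ * ‖β‖ ≤ γ ∧ ∀ e > 0, ∀ᶠ η in 𝓝 (0 : ℂ),
    Ψ (w + η) ≤ Ψ w + (α * η + β * η ^ 2).re - γ * ‖η‖ ^ 2 + e * ‖η‖ ^ 2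

/-- The linear term keeps the exact increment of g; only the quadratic terms are linearized. A first
derivative therefore suffices, and the increments can later be summed over the four directions. -/
theorem eventually_le_quadratic_of_hasDerivAt {Ψ : ℂ → ℝ} {g : ℝ → ℂ} {X α β : ℂ} {γ : ℝ}
    (hg : HasDerivAt g X 0)
    (hΨ : ∀ e > 0, ∀ᶠ η in 𝓝 (0 : ℂ),
      Ψ (g 0 + η) ≤ Ψ (g 0) + (α * η + β * η ^ 2).re - γ * ‖η‖ ^ 2 + e * ‖η‖ ^ 2)
    {e : ℝ} (he : 0 < e) :
    ∀ᶠ t in 𝓝 (0 : ℝ), Ψ (g t) ≤ Ψ (g 0) + (α * (g t - g 0)).re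
      + t ^ 2 * ((β * X ^ 2).re - γ * ‖X‖ ^ 2) + e * t ^ 2 := by
  -- s bounds the linearization error of g, d below weights the remainder in the jet; each costs at
  -- most e/2 · t².
  set s : ℝ := min 1 (e / (2 * ((‖β‖ + |γ|) * (2 * ‖X‖ + 1) + 1))) with hs_def
  have hs : 0 < s := by positivity
  have hs1 : s ≤ 1 := min_le_left _ _
  have hs2 : s * ((‖β‖ + |γ|) * (2 * ‖X‖ + 1)) ≤ e / 2 := by
    have h1 : s ≤ e / (2 * ((‖β‖ + |γ|) * (2 * ‖X‖ + 1) + 1)) := min_le_right _ _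
    rw [le_div_iff₀ (by positivity)] at h1
    nlinarith
  set d : ℝ := e / (2 * (‖X‖ + 1) ^ 2) with hd_def
  have hd : 0 < d := by positivity
  have hd2 : d * (‖X‖ + 1) ^ 2 = e / 2 := by rw [hd_def]; field_simp
  have hcont : Tendsto (fun t => g t - g 0) (𝓝 0) (𝓝 0) := by
    simpa using hg.continuousAt.tendsto.sub_const (g 0)
  have ho := (hasDerivAt_iff_isLittleO.1 hg).bound hs
  filter_upwards [hcont.eventually (hΨ d hd), ho] with t h1 h2
  set η := g t - g 0 with hη
  have hgt : g 0 + η = g t := by rw [hη]; ring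
  rw [hgt] at h1
  simp only [sub_zero] at h2
  set ρ := η - t • X with hρ
  have hρn : ‖ρ‖ ≤ s * |t| := h2
  have hηX : η = t • X + ρ := by rw [hρ]; ring
  have ht0 := abs_nonneg t
  have htX : ‖t • X‖ = |t| * ‖X‖ := by rw [norm_smul, Real.norm_eq_abs]
  have hηn : ‖η‖ ≤ |t| * (‖X‖ + 1) := by
    rw [hηX]
    refine (norm_add_le _ _).trans ?_
    rw [htX]; nlinarith
  have hsq : |t| ^ 2 = t ^ 2 := sq_abs t
  have hb1 : (β * η ^ 2).re ≤ t ^ 2 * (β * X ^ 2).re + ‖β‖ * (s * (2 * ‖X‖ + 1) * t ^ 2) := by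
    have e1 : β * η ^ 2 = ((t ^ 2 : ℝ) : ℂ) * (β * X ^ 2) + β * (ρ * (t • X + η)) := by
      rw [hηX]; simp only [Complex.real_smul]; push_cast; ring
    have e2 : ‖β * (ρ * (t • X + η))‖ ≤ ‖β‖ * (s * (2 * ‖X‖ + 1) * t ^ 2) := by
      rw [norm_mul, norm_mul]
      refine mul_le_mul_of_nonneg_left ?_ (norm_nonneg _)
      have e3 : ‖t • X + η‖ ≤ |t| * (2 * ‖X‖ + 1) := by
        refine (norm_add_le _ _).trans ?_
        rw [htX]; nlinarith
      calc ‖ρ‖ * ‖t • X + η‖ ≤ (s * |t|) * (|t| * (2 * ‖X‖ + 1)) := by gcongr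
        _ = s * (2 * ‖X‖ + 1) * t ^ 2 := by rw [← hsq]; ring
    rw [e1, Complex.add_re, Complex.re_ofReal_mul]
    linarith [Complex.re_le_norm (β * (ρ * (t • X + η)))]
  have hb2 : -(γ * ‖η‖ ^ 2) ≤ -(γ * (t ^ 2 * ‖X‖ ^ 2)) + |γ| * (s * (2 * ‖X‖ + 1) * t ^ 2) := by
    have e1 : |‖η‖ ^ 2 - t ^ 2 * ‖X‖ ^ 2| ≤ s * (2 * ‖X‖ + 1) * t ^ 2 := by
      have e2 : ‖η‖ ^ 2 - t ^ 2 * ‖X‖ ^ 2 = (‖η‖ - ‖t • X‖) * (‖η‖ + ‖t • X‖) := by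
        rw [htX, ← hsq]; ring
      have e3 : |‖η‖ - ‖t • X‖| ≤ s * |t| := (abs_norm_sub_norm_le _ _).trans hρn
      have e4 : |‖η‖ + ‖t • X‖| ≤ |t| * (2 * ‖X‖ + 1) := by
        rw [abs_of_nonneg (by positivity), htX]; nlinarith
      rw [e2, abs_mul]
      calc _ ≤ (s * |t|) * (|t| * (2 * ‖X‖ + 1)) := by gcongr
        _ = s * (2 * ‖X‖ + 1) * t ^ 2 := by rw [← hsq]; ring
    have e5 : |γ * (‖η‖ ^ 2 - t ^ 2 * ‖X‖ ^ 2)| ≤ |γ| * (s * (2 * ‖X‖ + 1) * t ^ 2) := by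
      rw [abs_mul]; gcongr
    linarith [(abs_le.1 e5).1]
  have hb3 : d * ‖η‖ ^ 2 ≤ e / 2 * t ^ 2 := by
    rw [← hd2, ← hsq, mul_assoc, ← mul_pow, mul_comm (‖X‖ + 1)]
    gcongr
  have hb4 : ‖β‖ * (s * (2 * ‖X‖ + 1) * t ^ 2) + |γ| * (s * (2 * ‖X‖ + 1) * t ^ 2)
      ≤ e / 2 * t ^ 2 := by
    have := mul_le_mul_of_nonneg_right hs2 (sq_nonneg t)
    linarith
  rw [Complex.add_re] at h1
  linarith

/-- The four linear terms add up to Re(α · `stencil f z h`), which is o(h²) by harmonicity. The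
quadratic terms add up to 2h² times Re β(X² + Y²) - γ(|X|² + |Y|²), which is nonpositive by `hκ` and
κ|β| ≤ γ. -/
theorem stencil_comp_le_of_hasSuperjet {f : ℂ → ℂ} {Ψ : ℂ → ℝ} {z : ℂ} {κ : ℝ}
    (hf : HarmonicAt f z)
    (hκ : ‖partialX f z ^ 2 + partialY f z ^ 2‖ ≤ κ * (‖partialX f z‖ ^ 2 + ‖partialY f z‖ ^ 2))
    (hΨ : HasSuperjet κ Ψ (f z)) {e : ℝ} (he : 0 < e) :
    ∀ᶠ h : ℝ in 𝓝[>] 0, stencil (fun z => Ψ (f z)) z h ≤ e * h ^ 2 := by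
  obtain ⟨α, β, γ, hγ, hjet⟩ := hΨ
  have hd : DifferentiableAt ℝ f z := hf.1.differentiableAt (by norm_num)
  have hX : HasDerivAt (fun t : ℝ => f (z + t • (1 : ℂ))) (partialX f z) 0 := by
    rw [partialX]; exact hd.lineDifferentiableAt.hasLineDerivAt
  have hY : HasDerivAt (fun t : ℝ => f (z + t • Complex.I)) (partialY f z) 0 := by
    rw [partialY]; exact hd.lineDifferentiableAt.hasLineDerivAt
  -- Four directional errors and one from the second difference of f.
  have he' : 0 < e / 5 := by positivity
  have evX := eventually_le_quadratic_of_hasDerivAt (Ψ := Ψ) hX (by simpa using hjet) he'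
  have evY := eventually_le_quadratic_of_hasDerivAt (Ψ := Ψ) hY (by simpa using hjet) he'
  have hneg : Tendsto (fun t : ℝ => -t) (𝓝 0) (𝓝 0) := by
    simpa using (tendsto_id (α := ℝ) (x := 𝓝 0)).neg
  have hS := ((HarmonicAt.stencil_isLittleO hf).const_mul_left α).bound he'
  refine nhdsWithin_le_nhds ?_
  filter_upwards [evX, evY, hneg.eventually evX, hneg.eventually evY, hS] with h h1 h2 h3 h4 h5
  have h6 : (α * stencil f z h).re ≤ e / 5 * h ^ 2 := by
    refine (Complex.re_le_norm _).trans (h5.trans ?_)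
    rw [Real.norm_of_nonneg (by positivity)]
  set X := partialX f z
  set Y := partialY f z
  have h7 : (β * X ^ 2).re + (β * Y ^ 2).re ≤ γ * (‖X‖ ^ 2 + ‖Y‖ ^ 2) := by
    rw [← Complex.add_re, ← mul_add]
    refine (Complex.re_le_norm _).trans ?_
    rw [norm_mul]
    calc _ ≤ ‖β‖ * (κ * (‖X‖ ^ 2 + ‖Y‖ ^ 2)) := by gcongr
      _ = κ * ‖β‖ * (‖X‖ ^ 2 + ‖Y‖ ^ 2) := by ring
      _ ≤ _ := by gcongr
  have h8 : 0 ≤ h ^ 2 * (γ * (‖X‖ ^ 2 + ‖Y‖ ^ 2) - ((β * X ^ 2).re + (β * Y ^ 2).re)) :=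
    mul_nonneg (sq_nonneg h) (by linarith)
  simp only [Complex.real_smul, mul_one, zero_smul, add_zero,
    Complex.ofReal_neg, neg_mul, neg_sq, ← sub_eq_add_neg, mul_comm (h : ℂ) Complex.I]
    at h1 h2 h3 h4
  simp only [stencil, nsmul_eq_mul, Nat.cast_ofNat] at h6 ⊢
  have h9 : (α * (f (z + h) + f (z - h) + f (z + Complex.I * h) + f (z - Complex.I * h) - 4 * f z)).re
      = (α * (f (z + h) - f z)).re + (α * (f (z - h) - f z)).re
        + (α * (f (z + Complex.I * h) - f z)).re + (α * (f (z - Complex.I * h) - f z)).re := by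
    simp only [← Complex.add_re]; congr 1; ring
  rw [h9] at h6
  linarith

/-- The distortion of a harmonic quasiregular map. -/
def distortion (K : ℝ) : ℝ := (K ^ 2 - 1) / (K ^ 2 + 1)

theorem distortion_nonneg {K : ℝ} (hK : 1 ≤ K) : 0 ≤ distortion K :=
  div_nonneg (by nlinarith) (by positivity)

/-- The exceptional set of the dilatation inequality is open by continuity of the derivatives, and
null, hence empty. With a = |f_z| and b = |f_z̄| it gives a + b ≤ K(a - b); squaring yields 2ab ≤
κ(a² + b²), while f_x² + f_y² = 4 f_z f_z̄. -/
theorem IsHarmonicQuasiregular.norm_sq_add_sq_le {K : ℝ} {f : ℂ → ℂ}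
    (hf : IsHarmonicQuasiregular K unitDisk f) {z : ℂ} (hz : z ∈ unitDisk) :
    ‖partialX f z ^ 2 + partialY f z ^ 2‖ ≤
      distortion K * (‖partialX f z‖ ^ 2 + ‖partialY f z‖ ^ 2) := by
  obtain ⟨hharm, hK, -, -, hae⟩ := hf
  have hopen : IsOpen unitDisk := Metric.isOpen_ball
  have hcd : ContDiffOn ℝ 2 f unitDisk := hharm.contDiffOn
  have hdiff : ∀ z ∈ unitDisk, DifferentiableAt ℝ f z := fun z hz =>
    (hharm z hz).1.differentiableAt (by norm_num)
  have hfd : ContinuousOn (fderiv ℝ f) unitDisk := hcd.continuousOn_fderiv_of_isOpen hopen (by norm_num)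
  have hline : ∀ v : ℂ, ContinuousOn (fun z => lineDeriv ℝ f z v) unitDisk := fun v =>
    (hfd.clm_apply (continuousOn_const (c := v))).congr fun z hz =>
      (hdiff z hz).lineDeriv_eq_fderiv
  have hXc : ContinuousOn (partialX f) unitDisk := hline 1
  have hYc : ContinuousOn (partialY f) unitDisk := hline Complex.I
  have hA : ContinuousOn (wirtinger f) unitDisk := by unfold wirtinger; fun_prop
  have hB : ContinuousOn (wirtingerBar f) unitDisk := by unfold wirtingerBar; fun_prop
  have hG : ContinuousOn (fun z => maxDilation f z ^ 2 - K * jacobian f z) unitDisk := by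
    unfold maxDilation jacobian; fun_prop
  have hbad : IsOpen (unitDisk ∩ (fun z => maxDilation f z ^ 2 - K * jacobian f z) ⁻¹' Ioi 0) :=
    hG.isOpen_inter_preimage hopen isOpen_Ioi
  have hnull : volume (unitDisk ∩ (fun z => maxDilation f z ^ 2 - K * jacobian f z) ⁻¹' Ioi 0) = 0 := by
    rw [ae_restrict_iff' hopen.measurableSet, ae_iff] at hae
    refine measure_mono_null (fun w hw => ?_) hae
    simp only [mem_ofPred_eq, Classical.not_imp, not_le]
    exact ⟨hw.1, sub_pos.1 hw.2⟩
  have hempty := (hbad.measure_eq_zero_iff volume).1 hnull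
  have hqr : maxDilation f z ^ 2 ≤ K * jacobian f z := by
    by_contra hcon
    have : z ∈ (∅ : Set ℂ) := hempty ▸ ⟨hz, by simp only [mem_preimage, mem_Ioi]; linarith⟩
    exact this
  rw [maxDilation, jacobian] at hqr
  have hprod : partialX f z ^ 2 + partialY f z ^ 2 = 4 * (wirtinger f z * wirtingerBar f z) := by
    rw [wirtinger, wirtingerBar]
    linear_combination (partialY f z) ^ 2 * Complex.I_sq
  have hsum : ‖partialX f z‖ ^ 2 + ‖partialY f z‖ ^ 2
      = 2 * (‖wirtinger f z‖ ^ 2 + ‖wirtingerBar f z‖ ^ 2) := by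
    have := parallelogram_law_with_norm ℝ (wirtinger f z) (wirtingerBar f z)
    have e1 : wirtinger f z + wirtingerBar f z = partialX f z := by
      rw [wirtinger, wirtingerBar]; ring
    have e2 : ‖wirtinger f z - wirtingerBar f z‖ = ‖partialY f z‖ := by
      have : wirtinger f z - wirtingerBar f z = -Complex.I * partialY f z := by
        rw [wirtinger, wirtingerBar]; ring
      rw [this, norm_mul]; simp
    rw [e1, e2] at this
    linarith
  rw [hprod, hsum, norm_mul, norm_mul, Complex.norm_ofNat, distortion]
  set a := ‖wirtinger f z‖
  set b := ‖wirtingerBar f z‖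
  have ha : 0 ≤ a := norm_nonneg _
  have hb : 0 ≤ b := norm_nonneg _
  rw [div_mul_eq_mul_div, le_div_iff₀ (by positivity)]
  have hsq : (a + b) ^ 2 ≤ K ^ 2 * (a - b) ^ 2 := by
    rcases (add_nonneg ha hb).eq_or_lt with h0 | hpos
    · have : (a + b) ^ 2 = 0 := by rw [← h0]; norm_num
      rw [this]; positivity
    · have h1 : a + b ≤ K * (a - b) := by
        refine le_of_mul_le_mul_right ?_ hpos
        nlinarith
      rw [← mul_pow]
      exact pow_le_pow_left₀ hpos.le h1 2
  nlinarith

/-- The super mean value inequality for `Ψ ∘ f`. -/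
theorem IsHarmonicQuasiregular.circleAverage_comp_le {K : ℝ} {f : ℂ → ℂ}
    (hf : IsHarmonicQuasiregular K unitDisk f) {Ψ : ℂ → ℝ} (hΨ : Continuous Ψ)
    (hjet : ∀ w, HasSuperjet (distortion K) Ψ w) {r : ℝ} (hr : r ∈ Ico (0 : ℝ) 1) :
    circleAverage (fun z => Ψ (f z)) 0 r ≤ Ψ (f 0) := by
  rcases hr.1.eq_or_lt with rfl | hpos
  · rw [circleAverage_zero]
  · have hsub : Metric.closedBall (0 : ℂ) r ⊆ unitDisk := Metric.closedBall_subset_ball hr.2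
    refine circleAverage_le_of_stencil_le (U := fun z => Ψ (f z)) hpos
      (hΨ.comp_continuousOn (hf.1.continuousOn.mono hsub)) fun z hz e he => ?_
    have hz' := hsub (Metric.ball_subset_closedBall hz)
    exact stencil_comp_le_of_hasSuperjet (hf.1 z hz') (hf.norm_sq_add_sq_le hz') (hjet _) he

end HarmonicQR

end

/-! ### The function behind the sharp inequality, and its superjets. -/

noncomputable section

namespace HarmonicQR

open Asymptotics

/-- The angle, in `[0, π / 2]`, between the line through `w` and the imaginary axis. -/
def axisAngle (w : ℂ) : ℝ := arcsin (|w.re| / ‖w‖)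

theorem axisAngle_nonneg (w : ℂ) : 0 ≤ axisAngle w := arcsin_nonneg.2 (by positivity)

theorem axisAngle_le (w : ℂ) : axisAngle w ≤ π / 2 := arcsin_le_pi_div_two _

theorem sin_axisAngle (w : ℂ) : sin (axisAngle w) = |w.re| / ‖w‖ :=
  sin_arcsin (by linarith [show 0 ≤ |w.re| / ‖w‖ by positivity])
    (div_le_one_of_le₀ (Complex.abs_re_le_norm w) (norm_nonneg w))

theorem norm_mul_sin_axisAngle (w : ℂ) : ‖w‖ * sin (axisAngle w) = |w.re| := by
  rcases eq_or_ne w 0 with rfl | hw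
  · simp
  · rw [sin_axisAngle, mul_div_cancel₀ _ (norm_ne_zero_iff.2 hw)]

theorem cos_axisAngle_nonneg (w : ℂ) : 0 ≤ cos (axisAngle w) :=
  cos_nonneg_of_mem_Icc ⟨by linarith [axisAngle_nonneg w, pi_pos], axisAngle_le w⟩

theorem norm_mul_cos_axisAngle (w : ℂ) : ‖w‖ * cos (axisAngle w) = |w.im| := by
  have h1 : (‖w‖ * cos (axisAngle w)) ^ 2 = |w.im| ^ 2 := by
    have h2 : ‖w‖ ^ 2 = w.re ^ 2 + w.im ^ 2 := by
      rw [← Complex.normSq_eq_norm_sq, Complex.normSq_apply]; ring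
    have h3 := norm_mul_sin_axisAngle w
    have h4 : (‖w‖ * sin (axisAngle w)) ^ 2 = w.re ^ 2 := by rw [h3, sq_abs]
    rw [sq_abs, mul_pow, cos_sq', mul_sub, mul_one, ← mul_pow, h4, h2]; ring
  exact (pow_left_inj₀ (mul_nonneg (norm_nonneg _) (cos_axisAngle_nonneg w)) (abs_nonneg _)
    two_ne_zero).1 h1

/-- The superharmonic function behind the sharp Riesz inequality with exponent `p`. -/
def sharpFun (p : ℝ) (w : ℂ) : ℝ := ‖w‖ ^ p * cos (p * min (axisAngle w) (π / p))

theorem abs_sharpFun_le (p : ℝ) (w : ℂ) : |sharpFun p w| ≤ ‖w‖ ^ p := by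
  rw [sharpFun, abs_mul, abs_of_nonneg (by positivity)]
  exact mul_le_of_le_one_right (by positivity) (abs_cos_le_one _)

theorem continuous_sharpFun {p : ℝ} (hp : 0 < p) : Continuous (sharpFun p) := by
  refine continuous_iff_continuousAt.2 fun w => ?_
  rcases eq_or_ne w 0 with rfl | hw
  · have h0 : sharpFun p 0 = 0 := by simp [sharpFun, hp.ne']
    have h1 : Tendsto (fun w : ℂ => ‖w‖ ^ p) (𝓝 0) (𝓝 0) := by
      have : Continuous fun w : ℂ => ‖w‖ ^ p := continuous_norm.rpow_const fun _ => Or.inr hp.le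
      simpa [hp.ne'] using this.tendsto 0
    rw [ContinuousAt, h0]
    exact squeeze_zero_norm (fun w => abs_sharpFun_le p w) h1
  · have h1 : ContinuousAt axisAngle w := by
      refine continuous_arcsin.continuousAt.comp (f := fun w : ℂ => |w.re| / ‖w‖) ?_
      exact ContinuousAt.div (by fun_prop) (by fun_prop) (norm_ne_zero_iff.2 hw)
    have h2 : ContinuousAt (fun w : ℂ => ‖w‖ ^ p) w :=
      continuous_norm.continuousAt.rpow_const (Or.inr hp.le)
    unfold sharpFun
    fun_prop

/-- Multiplication by a divides β by a² and γ by |a|², which preserves κ|β| ≤ γ. It serves to move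
the base point to 1 and to reflect through the origin. -/
theorem HasSuperjet.of_comp_mul_left {κ : ℝ} {Ψ : ℂ → ℝ} {a w : ℂ} (ha : a ≠ 0)
    (h : HasSuperjet κ (fun w => Ψ (a * w)) w) : HasSuperjet κ Ψ (a * w) := by
  obtain ⟨α, β, γ, hγ, hj⟩ := h
  have hna : 0 < ‖a‖ := norm_pos_iff.2 ha
  refine ⟨α / a, β / a ^ 2, γ / ‖a‖ ^ 2, ?_, fun e he => ?_⟩
  · rw [norm_div, norm_pow, mul_div_assoc']
    gcongr
  · have ht : Tendsto (fun η : ℂ => η / a) (𝓝 0) (𝓝 0) := by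
      simpa using (tendsto_id (α := ℂ) (x := 𝓝 0)).div_const a
    filter_upwards [ht.eventually (hj (e * ‖a‖ ^ 2) (by positivity))] with η hη
    have e1 : a * (w + η / a) = a * w + η := by field_simp
    rw [e1, norm_div] at hη
    refine hη.trans (le_of_eq ?_)
    congr 1
    · congr 1
      · congr 3 <;> field_simp
      · field_simp
    · field_simp

theorem HasSuperjet.of_comp_conj {κ : ℝ} {Ψ : ℂ → ℝ} {w : ℂ}
    (h : HasSuperjet κ (fun w => Ψ (starRingEnd ℂ w)) w) :
    HasSuperjet κ Ψ (starRingEnd ℂ w) := by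
  obtain ⟨α, β, γ, hγ, hj⟩ := h
  refine ⟨starRingEnd ℂ α, starRingEnd ℂ β, γ, by simpa using hγ, fun e he => ?_⟩
  have ht : Tendsto (fun η : ℂ => starRingEnd ℂ η) (𝓝 0) (𝓝 0) := by
    simpa using (Complex.continuous_conj.tendsto (0 : ℂ))
  filter_upwards [ht.eventually (hj e he)] with η hη
  simp only [map_add, Complex.conj_conj, RCLike.norm_conj] at hη
  refine hη.trans (le_of_eq ?_)
  congr 3
  rw [← Complex.conj_re]
  simp

/-- A function symmetric in both axes has superjets everywhere as soon as it has them in the closed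
first quadrant. -/
theorem HasSuperjet.of_symmetric {κ : ℝ} {Ψ : ℂ → ℝ} (hneg : ∀ w, Ψ (-w) = Ψ w)
    (hconj : ∀ w, Ψ (starRingEnd ℂ w) = Ψ w)
    (h : ∀ w : ℂ, 0 ≤ w.re → 0 ≤ w.im → HasSuperjet κ Ψ w) (w : ℂ) : HasSuperjet κ Ψ w := by
  have hN : ∀ w, HasSuperjet κ Ψ w → HasSuperjet κ Ψ (-w) := fun w hw => by
    have := HasSuperjet.of_comp_mul_left (κ := κ) (Ψ := Ψ) (a := -1) (w := w) (by norm_num)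
      (by simpa [hneg] using hw)
    simpa using this
  have hC : ∀ w, HasSuperjet κ Ψ w → HasSuperjet κ Ψ (starRingEnd ℂ w) := fun w hw =>
    HasSuperjet.of_comp_conj (by simpa [hconj] using hw)
  have hU : ∀ w : ℂ, 0 ≤ w.re → HasSuperjet κ Ψ w := fun w hw => by
    rcases le_total 0 w.im with hi | hi
    · exact h w hw hi
    · have := hC _ (h (starRingEnd ℂ w) (by simpa using hw) (by simpa using hi))
      simpa using this
  rcases le_total 0 w.re with hw | hw
  · exact hU w hw
  · have := hN _ (hU (-w) (by simpa using hw))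
    simpa using this

theorem arcsin_abs_sin {x : ℝ} (hx : |x| ≤ π / 2) : arcsin |sin x| = |x| := by
  have h := abs_nonneg x
  have habs : |sin x| = |sin (|x|)| := by rcases abs_choice x with h | h <;> simp [h]
  rw [habs, abs_of_nonneg (sin_nonneg_of_nonneg_of_le_pi h (by linarith [pi_pos]))]
  exact arcsin_sin (by linarith [pi_pos]) hx

/-- Below π/p the angle of the rotated point is |τ - s| and equality holds. From π/p on, that angle
is at least π/p - |s|, and cosine decreases on [0, π]. The arcsine accounts for crossing a
coordinate axis. -/
theorem eventually_cos_min_le {p : ℝ} (hp : 2 ≤ p) {τ : ℝ} (h0 : 0 ≤ τ) (h1 : τ ≤ π / 2) :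
    ∀ᶠ s in 𝓝 (0 : ℝ), cos (p * min (arcsin |sin (τ - s)|) (π / p)) ≤
      cos (p * s - p * min τ (π / p)) := by
  have hp0 : 0 < p := by linarith
  have hpp : 0 < π / p := by positivity
  have hp2 : π / p ≤ π / 2 := by gcongr
  have hpc : p * (π / p) = π := by field_simp
  rcases lt_or_ge τ (π / p) with hτ | hτ
  · have hev : ∀ᶠ s in 𝓝 (0 : ℝ), |τ - s| < π / p := by
      have : ContinuousAt (fun s : ℝ => |τ - s|) 0 := by fun_prop
      exact this.eventually_lt continuousAt_const (by simpa [abs_of_nonneg h0] using hτ)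
    filter_upwards [hev] with s hs
    rw [arcsin_abs_sin (hs.le.trans hp2), min_eq_left hs.le, min_eq_left hτ.le, ← mul_sub,
      ← cos_abs (p * (s - τ)), abs_mul, abs_of_pos hp0, abs_sub_comm]
  · have hev : ∀ᶠ s in 𝓝 (0 : ℝ), |s| < π / p := by
      have : ContinuousAt (fun s : ℝ => |s|) 0 := by fun_prop
      exact this.eventually_lt continuousAt_const (by simpa using hpp)
    filter_upwards [hev] with s hs
    have hs1 := neg_abs_le s
    have hs2 := le_abs_self s
    have ha0 : 0 ≤ |s| := abs_nonneg s
    have hge : π / p - |s| ≤ arcsin |sin (τ - s)| := by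
      rw [le_arcsin_iff_sin_le ⟨by linarith, by linarith⟩
        ⟨by linarith [abs_nonneg (sin (τ - s))], abs_sin_le_one _⟩]
      refine le_trans ?_ (le_abs_self _)
      rcases le_total (τ - s) (π / 2) with hx | hx
      · exact sin_le_sin_of_le_of_le_pi_div_two (by linarith) hx (by linarith)
      · rw [← sin_pi_sub (τ - s)]
        exact sin_le_sin_of_le_of_le_pi_div_two (by linarith) (by linarith) (by linarith)
    rw [min_eq_right hτ, hpc, cos_sub_pi, ← cos_abs (p * s), abs_mul, abs_of_pos hp0,
      ← cos_pi_sub]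
    have h3 : p * (π / p - |s|) = π - p * |s| := by rw [mul_sub, hpc]
    have h4 : 0 ≤ p * (π / p - |s|) := mul_nonneg hp0.le (by linarith)
    rw [← h3]
    refine cos_le_cos_of_nonneg_of_le_pi h4 ?_ ?_
    · calc _ ≤ p * (π / p) := by gcongr; exact min_le_right _ _
        _ = π := hpc
    · gcongr
      exact le_min hge (by linarith)

/-- In the first quadrant, multiplying by 1 + ξ lowers the angle to the imaginary axis by arg(1 +
ξ). The unit constant c carries the truncated phase at w, so the harmonic majorant touches at ξ = 0.
-/
theorem eventually_sharpFun_mul_le {p : ℝ} (hp : 2 ≤ p) {w : ℂ} (hw : w ≠ 0) (hre : 0 ≤ w.re)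
    (him : 0 ≤ w.im) :
    ∃ c : ℂ, ‖c‖ = 1 ∧ sharpFun p w = ‖w‖ ^ p * c.re ∧
      ∀ᶠ ξ in 𝓝 (0 : ℂ), sharpFun p (w * (1 + ξ)) ≤ ‖w‖ ^ p * (c * (1 + ξ) ^ (p : ℂ)).re := by
  set τ := axisAngle w with hτ
  set m := p * min τ (π / p) with hm
  refine ⟨Complex.exp (((-m : ℝ) : ℂ) * Complex.I), Complex.norm_exp_ofReal_mul_I _, ?_, ?_⟩
  · rw [Complex.exp_ofReal_mul_I_re, cos_neg, sharpFun]
  · have harg : Tendsto (fun ξ : ℂ => (1 + ξ).arg) (𝓝 0) (𝓝 0) := by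
      have h1 : ContinuousAt (fun ξ : ℂ => (1 + ξ).arg) 0 := by
        refine ContinuousAt.comp (g := Complex.arg) ?_ (by fun_prop)
        simpa using Complex.continuousAt_arg Complex.one_mem_slitPlane
      simpa [ContinuousAt] using h1
    have hne : ∀ᶠ ξ in 𝓝 (0 : ℂ), 1 + ξ ≠ 0 := by
      have : ContinuousAt (fun ξ : ℂ => 1 + ξ) 0 := by fun_prop
      exact this.eventually_ne (by simp)
    filter_upwards [harg.eventually (eventually_cos_min_le hp (axisAngle_nonneg w)
      (axisAngle_le w)), hne] with ξ hξ hξ0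
    set s := (1 + ξ).arg with hs
    have hρ : 0 < ‖1 + ξ‖ := norm_pos_iff.2 hξ0
    have hnw : 0 < ‖w‖ := norm_pos_iff.2 hw
    have hangle : axisAngle (w * (1 + ξ)) = arcsin |sin (τ - s)| := by
      have h1 : (w * (1 + ξ)).re = ‖w‖ * ‖1 + ξ‖ * sin (τ - s) := by
        have h2 := norm_mul_sin_axisAngle w
        have h3 := norm_mul_cos_axisAngle w
        rw [abs_of_nonneg hre] at h2
        rw [abs_of_nonneg him] at h3
        rw [Complex.mul_re, ← h2, ← h3, ← Complex.norm_mul_cos_arg (1 + ξ),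
          ← Complex.norm_mul_sin_arg (1 + ξ), sin_sub]
        ring
      rw [axisAngle, h1, norm_mul, abs_mul, abs_of_pos (by positivity : 0 < ‖w‖ * ‖1 + ξ‖),
        mul_div_cancel_left₀ _ (by positivity)]
    have hpow : (Complex.exp (((-m : ℝ) : ℂ) * Complex.I) * (1 + ξ) ^ (p : ℂ)).re
        = ‖1 + ξ‖ ^ p * cos (p * s - m) := by
      rw [Complex.cpow_ofReal, ← hs, mul_left_comm, Complex.re_ofReal_mul, Complex.mul_re,
        Complex.exp_ofReal_mul_I_re, Complex.exp_ofReal_mul_I_im]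
      congr 1
      simp only [Complex.add_re, Complex.add_im, Complex.ofReal_re, Complex.ofReal_im,
        Complex.re_ofReal_mul, Complex.im_ofReal_mul, Complex.I_re, Complex.I_im]
      rw [cos_sub, cos_neg, sin_neg, mul_comm p s]
      ring
    rw [hpow, sharpFun, hangle, norm_mul, mul_rpow hnw.le hρ.le, mul_assoc]
    gcongr

theorem one_add_cpow_isBigO (p : ℂ) :
    (fun ξ : ℂ => (1 + ξ) ^ p - (1 + p * ξ + p * (p - 1) / 2 * ξ ^ 2)) =O[𝓝 0]
      fun ξ => ‖ξ‖ ^ 3 := by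
  refine ((Complex.one_add_cpow_hasFPowerSeriesAt_zero (a := p)).isBigO_sub_partialSum_pow
    3).congr_left fun ξ => ?_
  have h2 : Ring.choose p 2 = p * (p - 1) / 2 := by
    rw [Ring.choose_eq_smul]
    simp [descPochhammer_succ_right, Polynomial.smeval_mul, Polynomial.smeval_sub,
      Polynomial.smeval_X]
    ring
  simp [FormalMultilinearSeries.partialSum, Finset.sum_range_succ, binomialSeries, h2]
  ring

/-- Bernoulli's inequality with exponent p/2 for |1 + ξ|² = 1 + (2 Re ξ + |ξ|²). -/
theorem one_add_le_norm_rpow {p : ℝ} (hp : 2 ≤ p) (ξ : ℂ) :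
    1 + p * ξ.re + p / 2 * ‖ξ‖ ^ 2 ≤ ‖1 + ξ‖ ^ p := by
  have h1 : ‖1 + ξ‖ ^ 2 = 1 + (2 * ξ.re + ‖ξ‖ ^ 2) := by
    simp only [← Complex.normSq_eq_norm_sq, Complex.normSq_apply]
    simp
    ring
  have h2 : ‖1 + ξ‖ ^ p = (1 + (2 * ξ.re + ‖ξ‖ ^ 2)) ^ (p / 2) := by
    rw [← h1, ← rpow_natCast, ← rpow_mul (norm_nonneg _)]
    congr 1
    push_cast; ring
  rw [h2]
  refine le_trans (le_of_eq ?_) (one_add_mul_self_le_rpow_one_add ?_ (by linarith))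
  · ring
  · nlinarith [sq_nonneg ‖1 + ξ‖]

theorem sharpFun_neg (p : ℝ) (w : ℂ) : sharpFun p (-w) = sharpFun p w := by
  simp [sharpFun, axisAngle]

theorem sharpFun_conj (p : ℝ) (w : ℂ) : sharpFun p (starRingEnd ℂ w) = sharpFun p w := by
  simp [sharpFun, axisAngle]

theorem sharpFun_two (w : ℂ) : sharpFun 2 w = -(w ^ 2).re := by
  have h1 := norm_mul_sin_axisAngle w
  have h2 := norm_mul_cos_axisAngle w
  rw [sharpFun, min_eq_left (axisAngle_le w), cos_two_mul', rpow_two, mul_sub, ← mul_pow,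
    ← mul_pow, h1, h2, sq_abs, sq_abs, sq w, Complex.mul_re]
  ring

/-- For p = 2 the function is exactly quadratic; for p > 2 it is bounded above by |η|^p = o(|η|²).
-/
theorem hasSuperjet_sharpFun_zero {p κ : ℝ} (hp : 2 ≤ p) (hκ : 0 ≤ κ) :
    HasSuperjet κ (fun w => sharpFun p w - (p - 1) * κ * ‖w‖ ^ p) 0 := by
  have hp0 : p ≠ 0 := by linarith
  rcases hp.eq_or_lt with rfl | hp2
  · refine ⟨0, -1, κ, by simp, fun e he => Eventually.of_forall fun η => ?_⟩
    simp only [zero_add, sharpFun_two]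
    simp only [rpow_two, zero_mul, zero_add, norm_zero]
    norm_num
    positivity
  · refine ⟨0, 0, 0, by simp, fun e he => ?_⟩
    have h1 : Tendsto (fun η : ℂ => ‖η‖ ^ (p - 2)) (𝓝 0) (𝓝 0) := by
      have : Continuous fun w : ℂ => ‖w‖ ^ (p - 2) :=
        continuous_norm.rpow_const fun _ => Or.inr (by linarith)
      simpa [(by linarith : p - 2 ≠ 0)] using this.tendsto 0
    filter_upwards [h1.eventually (gt_mem_nhds he)] with η hη
    have h2 : ‖η‖ ^ p = ‖η‖ ^ (p - 2) * ‖η‖ ^ 2 := by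
      rw [← rpow_two, ← rpow_add' (norm_nonneg _) (by simpa using hp0)]
      congr 1; ring
    have h3 := (abs_le.1 (abs_sharpFun_le p η)).2
    have h4 : 0 ≤ (p - 1) * κ * ‖η‖ ^ p :=
      mul_nonneg (mul_nonneg (by linarith) hκ) (by positivity)
    have h5 : ‖η‖ ^ p ≤ e * ‖η‖ ^ 2 := by rw [h2]; gcongr
    have h0 : sharpFun p 0 = 0 := by simp [sharpFun, hp0]
    simp [h0, hp0]
    linarith

theorem hasSuperjet_sharpFun {p κ : ℝ} (hp : 2 ≤ p) (hκ : 0 ≤ κ) (w : ℂ) :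
    HasSuperjet κ (fun w => sharpFun p w - (p - 1) * κ * ‖w‖ ^ p) w := by
  refine HasSuperjet.of_symmetric (by simp [sharpFun_neg]) (by simp [sharpFun_conj])
    (fun w hre him => ?_) w
  rcases eq_or_ne w 0 with rfl | hw
  · exact hasSuperjet_sharpFun_zero hp hκ
  have hmul : HasSuperjet κ
      (fun x => (fun w => sharpFun p w - (p - 1) * κ * ‖w‖ ^ p) (w * x)) 1 := by
    obtain ⟨c, hc1, hc0, hc⟩ := eventually_sharpFun_mul_le hp hw hre him
    set N := ‖w‖ ^ p with hN
    have hN0 : 0 < N := rpow_pos_of_pos (norm_pos_iff.2 hw) _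
    have hp1 : 0 ≤ p * (p - 1) / 2 := by nlinarith
    -- β comes from the binomial expansion of (1 + ξ)^p and γ from the Bernoulli bound on the
    -- subtracted power. The factor (p - 1)κ is what makes κ|β| = γ.
    refine ⟨N * (c * p - (p - 1) * κ * p), N * (c * (p * (p - 1) / 2)),
      N * ((p - 1) * κ * (p / 2)), ?_, fun e he => ?_⟩
    · have : ‖(N : ℂ) * (c * (p * (p - 1) / 2))‖ = N * (p * (p - 1) / 2) := by
        have h1 : ((p : ℂ) * (p - 1) / 2) = ((p * (p - 1) / 2 : ℝ) : ℂ) := by push_cast; ring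
        rw [h1, norm_mul, norm_mul, hc1, Complex.norm_of_nonneg hN0.le,
          Complex.norm_of_nonneg hp1, one_mul]
      rw [this]
      exact le_of_eq (by ring)
    · have h3 : (fun ξ : ℂ => ‖ξ‖ ^ 3) =o[𝓝 0] fun ξ => ‖ξ‖ ^ 2 := by
        have := (isLittleO_pow_pow (𝕜 := ℝ) (show 2 < 3 by norm_num)).comp_tendsto
          (tendsto_norm_zero (E := ℂ))
        simpa [Function.comp_def] using this
      have hO := ((one_add_cpow_isBigO (p : ℂ)).trans_isLittleO h3).bound
        (show 0 < e / N by positivity)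
      filter_upwards [hc, hO] with ξ h1 h2
      have h4 := one_add_le_norm_rpow hp ξ
      set R := (1 + ξ) ^ (p : ℂ) - (1 + p * ξ + p * (p - 1) / 2 * ξ ^ 2) with hR
      have h5 : (1 + ξ) ^ (p : ℂ) = 1 + p * ξ + p * (p - 1) / 2 * ξ ^ 2 + R := by
        rw [hR]; ring
      have h6 : N * (c * R).re ≤ e * ‖ξ‖ ^ 2 := by
        have : (c * R).re ≤ e / N * ‖ξ‖ ^ 2 := by
          refine (Complex.re_le_norm _).trans ?_
          rw [norm_mul, hc1, one_mul]
          simpa using h2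
        calc _ ≤ N * (e / N * ‖ξ‖ ^ 2) := by gcongr
          _ = e * ‖ξ‖ ^ 2 := by field_simp
      have h7 : N * (c * (1 + ξ) ^ (p : ℂ)).re = N * c.re
          + (N * (c * p) * ξ + N * (c * (p * (p - 1) / 2)) * ξ ^ 2).re + N * (c * R).re := by
        rw [h5]
        simp only [← Complex.re_ofReal_mul, ← Complex.add_re]
        congr 1; ring
      have h8 : ((N : ℂ) * (c * p - (p - 1) * κ * p) * ξ + N * (c * (p * (p - 1) / 2)) * ξ ^ 2).re
          = (N * (c * p) * ξ + N * (c * (p * (p - 1) / 2)) * ξ ^ 2).re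
            - N * ((p - 1) * κ * p) * ξ.re := by
        rw [← Complex.re_ofReal_mul, ← Complex.sub_re]
        congr 1; push_cast; ring
      have h9 : (p - 1) * κ * ‖w * (1 + ξ)‖ ^ p
          ≥ (p - 1) * κ * (N * (1 + p * ξ.re + p / 2 * ‖ξ‖ ^ 2)) := by
        rw [norm_mul, mul_rpow (norm_nonneg _) (norm_nonneg _)]
        have : 0 ≤ (p - 1) * κ := mul_nonneg (by linarith) hκ
        gcongr
      simp only [mul_one]
      rw [h8, hc0, ← hN]
      linarith
  have := HasSuperjet.of_comp_mul_left
    (Ψ := fun w => sharpFun p w - (p - 1) * κ * ‖w‖ ^ p) hw hmul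
  rwa [mul_one] at this

end HarmonicQR

end

/-! ### Pointwise trigonometric inequalities. -/

noncomputable section

namespace HarmonicQR

/-- The derivative has the sign of sin((q - 1)t). With q = p - 1 this decides the sign of the
derivative in the next inequality. -/
theorem monotoneOn_sin_rpow_div_sin_mul {q : ℝ} (hq : 1 ≤ q) :
    MonotoneOn (fun t => sin t ^ q / sin (q * t)) (Ioo 0 (π / q)) := by
  have hq0 : 0 < q := by linarith
  have hpos : ∀ t ∈ Ioo 0 (π / q), 0 < sin t ∧ 0 < sin (q * t) ∧ 0 ≤ sin (q * t - t) := by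
    intro t ht
    have h1 : q * t < π := by
      have := (lt_div_iff₀ hq0).1 ht.2
      linarith
    have h2 : t ≤ q * t := by nlinarith [ht.1]
    have h3 := ht.1
    exact ⟨sin_pos_of_pos_of_lt_pi h3 (by linarith),
      sin_pos_of_pos_of_lt_pi (by positivity) h1,
      sin_nonneg_of_nonneg_of_le_pi (by linarith) (by linarith)⟩
  have hder : ∀ t ∈ Ioo 0 (π / q), HasDerivAt (fun t => sin t ^ q / sin (q * t))
      (q * sin t ^ (q - 1) * sin (q * t - t) / sin (q * t) ^ 2) t := by
    intro t ht
    obtain ⟨h1, h2, -⟩ := hpos t ht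
    have d1 : HasDerivAt (fun t => sin t ^ q) (cos t * q * sin t ^ (q - 1)) t :=
      (hasDerivAt_sin t).rpow_const (Or.inl h1.ne')
    have d2 : HasDerivAt (fun t => sin (q * t)) (cos (q * t) * q) t := by
      simpa using ((hasDerivAt_id t).const_mul q).sin
    refine (d1.div d2 h2.ne').congr_deriv ?_
    have h3 : sin t ^ q = sin t * sin t ^ (q - 1) := by
      rw [← rpow_one_add' h1.le (by linarith)]; congr 1; ring
    rw [h3, sin_sub]
    congr 1; ring
  refine monotoneOn_of_deriv_nonneg (convex_Ioo _ _)
    (fun t ht => (hder t ht).continuousAt.continuousWithinAt) ?_ ?_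
  · rw [interior_Ioo]
    exact fun t ht => (hder t ht).differentiableAt.differentiableWithinAt
  · rw [interior_Ioo]
    intro t ht
    obtain ⟨h1, h2, h3⟩ := hpos t ht
    rw [(hder t ht).deriv]
    positivity

/-- Divided by cos^p t, the right side becomes a function H that decreases up to a = π/(2p),
increases afterwards, and equals 1 at a because cos(pa) = 0. -/
theorem cos_rpow_le_of_le_pi_div {p : ℝ} (hp : 2 ≤ p) {t : ℝ} (h0 : 0 ≤ t) (h1 : t ≤ π / p) :
    cos t ^ p ≤ (cos (π / (2 * p)) / sin (π / (2 * p))) ^ p * sin t ^ p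
      + cos (π / (2 * p)) ^ (p - 1) / sin (π / (2 * p)) * cos (p * t) := by
  have hp0 : 0 < p := by linarith
  have hpi := pi_pos
  rcases hp.eq_or_lt with rfl | hp2
  -- For p = 2 the endpoint π/2 makes cos t vanish and H is unusable, but the claim is the identity
  -- for cos 2t.
  · have e1 : π / (2 * 2) = π / 4 := by ring
    have e2 : (2 : ℝ) - 1 = 1 := by norm_num
    have e3 : (√2 / 2 : ℝ) ≠ 0 := by positivity
    rw [e1, cos_pi_div_four, sin_pi_div_four, e2, rpow_one, div_self e3, one_rpow, cos_two_mul',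
      rpow_two, rpow_two]
    linarith
  set a := π / (2 * p) with ha
  have ha0 : 0 < a := by positivity
  have hab : π / p = 2 * a := by rw [ha]; field_simp
  have hpa : p * a = π / 2 := by rw [ha]; field_simp
  have ha4 : 2 * a < π / 2 := by nlinarith
  have hS : 0 < sin a := sin_pos_of_pos_of_lt_pi ha0 (by linarith)
  have hC : 0 < cos a := cos_pos_of_mem_Ioo ⟨by linarith, by linarith⟩
  rw [hab] at h1
  set B := cos a ^ (p - 1) / sin a with hB
  have hB0 : 0 < B := by positivity
  have hcos : ∀ x ∈ Icc 0 (2 * a), 0 < cos x := fun x hx =>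
    cos_pos_of_mem_Ioo ⟨by linarith [hx.1], by linarith [hx.2]⟩
  -- This is the condition H'(a) = 0, which dictates the value of B.
  have hCB : (cos a / sin a) ^ p * sin a ^ (p - 1) = B * cos a := by
    rw [div_rpow hC.le hS.le, hB, rpow_sub_one hS.ne', rpow_sub_one hC.ne']
    field_simp
  let H : ℝ → ℝ := fun x => ((cos a / sin a) ^ p * sin x ^ p + B * cos (p * x)) / cos x ^ p
  have hH : ∀ x ∈ Ioo 0 (2 * a), HasDerivAt H
      (p * ((cos a / sin a) ^ p * sin x ^ (p - 1) - B * sin ((p - 1) * x)) / cos x ^ (p + 1)) x := by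
    intro x hx
    have hc := hcos x (Ioo_subset_Icc_self hx)
    have hs : 0 < sin x := sin_pos_of_pos_of_lt_pi hx.1 (by linarith [hx.2])
    have d1 : HasDerivAt (fun t => sin t ^ p) (cos x * p * sin x ^ (p - 1)) x :=
      (hasDerivAt_sin x).rpow_const (Or.inl hs.ne')
    have d2 : HasDerivAt (fun t => cos t ^ p) (-sin x * p * cos x ^ (p - 1)) x :=
      (hasDerivAt_cos x).rpow_const (Or.inl hc.ne')
    have d3 : HasDerivAt (fun t => cos (p * t)) (-sin (p * x) * p) x := by
      simpa using ((hasDerivAt_id x).const_mul p).cos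
    refine (((d1.const_mul _).add (d3.const_mul B)).div d2 (rpow_pos_of_pos hc _).ne').congr_deriv ?_
    have e1 : sin ((p - 1) * x) = sin (p * x) * cos x - cos (p * x) * sin x := by
      rw [← sin_sub]; congr 1; ring
    have e2 : sin x ^ p = sin x ^ (p - 1) * sin x := by
      rw [rpow_sub_one hs.ne']; field_simp
    have e3 : cos x ^ p = cos x ^ (p - 1) * cos x := by
      rw [rpow_sub_one hc.ne']; field_simp
    have e4 : cos x ^ (p + 1) = cos x ^ (p - 1) * cos x * cos x := by
      rw [rpow_add_one hc.ne', e3]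
    have e5 : 0 < cos x ^ (p - 1) := by positivity
    rw [Pi.add_apply, e1, e4, e2, e3]
    field_simp
    linear_combination ((cos a / sin a) ^ p * sin x ^ (p - 1)) * (sin_sq_add_cos_sq x)
  have hHc : ContinuousOn H (Icc 0 (2 * a)) := by
    intro x hx
    have hc := hcos x hx
    have h1 : ContinuousAt (fun x => sin x ^ p) x :=
      continuous_sin.continuousAt.rpow_const (Or.inr hp0.le)
    have h2 : ContinuousAt (fun x => cos x ^ p) x :=
      continuous_cos.continuousAt.rpow_const (Or.inr hp0.le)
    refine ContinuousAt.continuousWithinAt (ContinuousAt.div ?_ h2 (by positivity))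
    fun_prop
  have hsub : ∀ x ∈ Ioo 0 (2 * a), x ∈ Ioo 0 (π / (p - 1)) := fun x hx => by
    refine ⟨hx.1, hx.2.trans ?_⟩
    rw [lt_div_iff₀ (by linarith)]
    nlinarith
  have haI : a ∈ Ioo 0 (2 * a) := ⟨ha0, by linarith⟩
  have hmono := monotoneOn_sin_rpow_div_sin_mul (q := p - 1) (by linarith)
  have hsa : sin ((p - 1) * a) = cos a := by
    rw [← sin_pi_div_two_sub]; congr 1; rw [← hpa]; ring
  have hsx : ∀ x ∈ Ioo 0 (2 * a), 0 < sin ((p - 1) * x) := fun x hx => by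
    refine sin_pos_of_pos_of_lt_pi (mul_pos (by linarith) hx.1) ?_
    have := (lt_div_iff₀ (by linarith)).1 (hsub x hx).2
    linarith
  have hleft : ∀ x ∈ Ioo 0 (2 * a), x ≤ a →
      (cos a / sin a) ^ p * sin x ^ (p - 1) ≤ B * sin ((p - 1) * x) := by
    intro x hx hxa
    have := hmono (hsub x hx) (hsub a haI) hxa
    simp only [hsa] at this
    rw [div_le_div_iff₀ (hsx x hx) hC] at this
    have h2 : 0 ≤ (cos a / sin a) ^ p := by positivity
    refine le_of_mul_le_mul_right ?_ hC
    calc _ = (cos a / sin a) ^ p * (sin x ^ (p - 1) * cos a) := by ring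
      _ ≤ (cos a / sin a) ^ p * (sin a ^ (p - 1) * sin ((p - 1) * x)) := by gcongr
      _ = _ := by rw [← mul_assoc, hCB]; ring
  have hright : ∀ x ∈ Ioo 0 (2 * a), a ≤ x →
      B * sin ((p - 1) * x) ≤ (cos a / sin a) ^ p * sin x ^ (p - 1) := by
    intro x hx hxa
    have := hmono (hsub a haI) (hsub x hx) hxa
    simp only [hsa] at this
    rw [div_le_div_iff₀ hC (hsx x hx)] at this
    have h2 : 0 ≤ (cos a / sin a) ^ p := by positivity
    refine le_of_mul_le_mul_right ?_ hC
    calc _ = (cos a / sin a) ^ p * (sin a ^ (p - 1) * sin ((p - 1) * x)) := by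
          rw [← mul_assoc, hCB]; ring
      _ ≤ (cos a / sin a) ^ p * (sin x ^ (p - 1) * cos a) := by gcongr
      _ = _ := by ring
  have hHa : H a = 1 := by
    simp only [H]
    rw [hpa, cos_pi_div_two, mul_zero, add_zero, ← mul_rpow (by positivity) hS.le,
      div_mul_cancel₀ _ hS.ne', div_self (by positivity)]
  have hanti : AntitoneOn H (Icc 0 a) := by
    refine antitoneOn_of_deriv_nonpos (convex_Icc _ _)
      (hHc.mono (Icc_subset_Icc_right (by linarith))) ?_ ?_ <;> rw [interior_Icc] <;>
      intro x hx <;> have hx' : x ∈ Ioo 0 (2 * a) := ⟨hx.1, by linarith [hx.2]⟩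
    · exact (hH x hx').differentiableAt.differentiableWithinAt
    · rw [(hH x hx').deriv]
      have hc := hcos x (Ioo_subset_Icc_self hx')
      exact div_nonpos_of_nonpos_of_nonneg
        (mul_nonpos_of_nonneg_of_nonpos hp0.le (by linarith [hleft x hx' hx.2.le])) (by positivity)
  have hmon : MonotoneOn H (Icc a (2 * a)) := by
    refine monotoneOn_of_deriv_nonneg (convex_Icc _ _)
      (hHc.mono (Icc_subset_Icc_left (by linarith))) ?_ ?_ <;> rw [interior_Icc] <;>
      intro x hx <;> have hx' : x ∈ Ioo 0 (2 * a) := ⟨by linarith [hx.1], hx.2⟩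
    · exact (hH x hx').differentiableAt.differentiableWithinAt
    · rw [(hH x hx').deriv]
      have hc := hcos x (Ioo_subset_Icc_self hx')
      exact div_nonneg
        (mul_nonneg hp0.le (by linarith [hright x hx' hx.1.le])) (by positivity)
  have hge : 1 ≤ H t := by
    rw [← hHa]
    rcases le_total t a with hta | hta
    · exact hanti ⟨h0, hta⟩ ⟨ha0.le, le_rfl⟩ hta
    · exact hmon ⟨le_rfl, by linarith⟩ ⟨hta, h1⟩ hta
  have hct := hcos t ⟨h0, h1⟩
  rwa [one_le_div (by positivity)] at hge

/-- Beyond π/p the last term is frozen, the cosine power decreases and the sine power increases, so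
the case t = π/p suffices. -/
theorem cos_rpow_le {p : ℝ} (hp : 2 ≤ p) {t : ℝ} (h0 : 0 ≤ t) (h1 : t ≤ π / 2) :
    cos t ^ p ≤ (cos (π / (2 * p)) / sin (π / (2 * p))) ^ p * sin t ^ p
      + cos (π / (2 * p)) ^ (p - 1) / sin (π / (2 * p)) * cos (p * min t (π / p)) := by
  have hp0 : 0 < p := by linarith
  have hpi := pi_pos
  have hpp : 0 < π / p := by positivity
  have hp2 : π / p ≤ π / 2 := by gcongr
  rcases le_total t (π / p) with ht | ht
  · rw [min_eq_left ht]
    exact cos_rpow_le_of_le_pi_div hp h0 ht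
  · rw [min_eq_right ht]
    refine le_trans ?_ ((cos_rpow_le_of_le_pi_div hp hpp.le le_rfl).trans ?_)
    · exact rpow_le_rpow (cos_nonneg_of_mem_Icc ⟨by linarith, h1⟩)
        (cos_le_cos_of_nonneg_of_le_pi hpp.le (by linarith) ht) hp0.le
    · have h2 : 0 ≤ cos (π / (2 * p)) / sin (π / (2 * p)) := by
        have h3 : π / (2 * p) ≤ π / 2 := by gcongr; linarith
        have h4 : 0 < π / (2 * p) := by positivity
        exact div_nonneg (cos_nonneg_of_mem_Icc ⟨by linarith, h3⟩)
          (sin_nonneg_of_nonneg_of_le_pi h4.le (by linarith))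
      have h5 : sin (π / p) ^ p ≤ sin t ^ p :=
        rpow_le_rpow (sin_nonneg_of_nonneg_of_le_pi hpp.le (by linarith))
          (sin_le_sin_of_le_of_le_pi_div_two (by linarith) h1 ht) hp0.le
      have h6 := mul_le_mul_of_nonneg_left h5 (rpow_nonneg h2 p)
      linarith

theorem abs_im_rpow_le {p : ℝ} (hp : 2 ≤ p) (w : ℂ) :
    |w.im| ^ p ≤ (cos (π / (2 * p)) / sin (π / (2 * p))) ^ p * |w.re| ^ p
      + cos (π / (2 * p)) ^ (p - 1) / sin (π / (2 * p)) * sharpFun p w := by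
  have h := mul_le_mul_of_nonneg_left (cos_rpow_le hp (axisAngle_nonneg w) (axisAngle_le w))
    (rpow_nonneg (norm_nonneg w) p)
  rw [← norm_mul_cos_axisAngle w, ← norm_mul_sin_axisAngle w,
    mul_rpow (norm_nonneg _) (cos_axisAngle_nonneg w), mul_rpow (norm_nonneg _)
      (sin_nonneg_of_nonneg_of_le_pi (axisAngle_nonneg w)
        ((axisAngle_le w).trans (by linarith [pi_pos]))), sharpFun]
  linarith

/-- Jensen for x^(p/2) with weights sin² a and cos² a, applied to |w|² = sin² a (|u|/sin a)² + cos²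
a (|v|/cos a)²; then the bound for |v|^p is inserted. -/
theorem norm_rpow_le {p : ℝ} (hp : 2 ≤ p) (w : ℂ) :
    ‖w‖ ^ p ≤ (1 / sin (π / (2 * p))) ^ p * |w.re| ^ p
      + cos (π / (2 * p)) / sin (π / (2 * p)) * sharpFun p w := by
  have hp0 : 0 < p := by linarith
  have hpi := pi_pos
  have h3 : π / (2 * p) < π / 2 := by gcongr; linarith
  have h4 : 0 < π / (2 * p) := by positivity
  have him := abs_im_rpow_le hp w
  set a := π / (2 * p) with ha
  have hS : 0 < sin a := sin_pos_of_pos_of_lt_pi h4 (by linarith)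
  have hC : 0 < cos a := cos_pos_of_mem_Ioo ⟨by linarith, h3⟩
  have hsq : ∀ x : ℝ, 0 ≤ x → (x ^ 2) ^ (p / 2) = x ^ p := fun x hx => by
    rw [← rpow_natCast, ← rpow_mul hx]; congr 1; push_cast; ring
  have hconv := (convexOn_rpow (show 1 ≤ p / 2 by linarith)).2
    (show (|w.re| / sin a) ^ 2 ∈ Ici (0 : ℝ) from mem_Ici.2 (sq_nonneg _))
    (show (|w.im| / cos a) ^ 2 ∈ Ici (0 : ℝ) from mem_Ici.2 (sq_nonneg _))
    (sq_nonneg (sin a)) (sq_nonneg (cos a)) (sin_sq_add_cos_sq a)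
  have hw : sin a ^ 2 • (|w.re| / sin a) ^ 2 + cos a ^ 2 • (|w.im| / cos a) ^ 2 = ‖w‖ ^ 2 := by
    rw [smul_eq_mul, smul_eq_mul, ← Complex.normSq_eq_norm_sq, Complex.normSq_apply,
      ← mul_pow, ← mul_pow, mul_div_cancel₀ _ hS.ne', mul_div_cancel₀ _ hC.ne', sq_abs, sq_abs]
    ring
  beta_reduce at hconv
  rw [hw, hsq _ (norm_nonneg w), hsq _ (by positivity), hsq _ (by positivity),
    div_rpow (abs_nonneg _) hS.le, div_rpow (abs_nonneg _) hC.le, smul_eq_mul, smul_eq_mul] at hconv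
  refine hconv.trans ?_
  have hSp : 0 < sin a ^ p := by positivity
  have hCp : 0 < cos a ^ p := by positivity
  rw [div_rpow hC.le hS.le, rpow_sub_one hC.ne'] at him
  have h5 : cos a ^ 2 * (|w.im| ^ p / cos a ^ p) ≤ cos a ^ 2 / cos a ^ p *
      (cos a ^ p / sin a ^ p * |w.re| ^ p + cos a ^ p / cos a / sin a * sharpFun p w) := by
    rw [mul_div_assoc', mul_div_right_comm]
    gcongr
  have h6 : cos a ^ 2 / cos a ^ p *
      (cos a ^ p / sin a ^ p * |w.re| ^ p + cos a ^ p / cos a / sin a * sharpFun p w)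
      = cos a ^ 2 / sin a ^ p * |w.re| ^ p + cos a / sin a * sharpFun p w := by
    field_simp
  have h7 : (1 / sin a) ^ p * |w.re| ^ p = sin a ^ 2 * (|w.re| ^ p / sin a ^ p)
      + cos a ^ 2 / sin a ^ p * |w.re| ^ p := by
    rw [div_rpow zero_le_one hS.le, one_rpow]
    field_simp
    rw [sin_sq_add_cos_sq, mul_one]
  linarith

end HarmonicQR

end

/-! ### Burkholder's function and a nonsharp bound for arbitrary distortion. -/

noncomputable section

namespace HarmonicQR

/-- Burkholder's function for the maximal weak type inequality, at level `l`. -/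
def burkholder (L l : ℝ) (w : ℂ) : ℝ :=
  if L * |w.re| + |w.im| ≤ l then 0 else (|w.im| - l) ^ 2 - (L * |w.re|) ^ 2

theorem continuous_burkholder (L : ℝ) : Continuous fun x : ℝ × ℂ => burkholder L x.1 x.2 := by
  unfold burkholder
  refine Continuous.if_le (by fun_prop) (by fun_prop) (by fun_prop) (by fun_prop) fun x hx => ?_
  rw [← hx]; ring

theorem burkholder_le {L l : ℝ} (hL : 0 ≤ L) (hl : 0 ≤ l) (w : ℂ) :
    burkholder L l w ≤ (w.im - l) ^ 2 - (L * w.re) ^ 2 := by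
  have h1 : (L * |w.re|) ^ 2 = (L * w.re) ^ 2 := by rw [mul_pow, sq_abs, mul_pow]
  have h2 := le_abs_self w.im
  rw [burkholder]
  split_ifs with h
  · rw [← h1]
    have : 0 ≤ L * |w.re| := by positivity
    nlinarith
  · rw [h1]
    nlinarith [sq_abs w.im]

/-- In the first quadrant the outer quadratic majorizes the function globally and touches it
wherever L|u| + |v| ≥ l; elsewhere the function is locally 0. The quadratic satisfies the jet
condition because K ≤ L. -/
theorem hasSuperjet_burkholder {K L l : ℝ} (hK : 1 ≤ K) (hKL : K ≤ L) (hl : 0 ≤ l) (w : ℂ) :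
    HasSuperjet (distortion K) (burkholder L l) w := by
  refine HasSuperjet.of_symmetric (by simp [burkholder]) (by simp [burkholder])
    (fun w hre him => ?_) w
  rcases lt_or_ge (L * |w.re| + |w.im|) l with h | h
  · refine ⟨0, 0, 0, by simp, fun e he => ?_⟩
    have hc : ContinuousAt (fun η : ℂ => L * |(w + η).re| + |(w + η).im|) 0 := by fun_prop
    filter_upwards [hc.eventually_lt continuousAt_const (by simpa using h)] with η hη
    rw [burkholder, burkholder, if_pos hη.le, if_pos h.le]
    simp
    positivity
  · have hval : burkholder L l w = (w.im - l) ^ 2 - (L * w.re) ^ 2 := by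
      rw [burkholder, abs_of_nonneg hre, abs_of_nonneg him]
      rw [abs_of_nonneg hre, abs_of_nonneg him] at h
      split_ifs with h'
      · rw [← le_antisymm h' h]; ring
      · rfl
    refine ⟨⟨-2 * L ^ 2 * w.re, -2 * (w.im - l)⟩, ((-(1 + L ^ 2) / 2 : ℝ) : ℂ), (L ^ 2 - 1) / 2,
      ?_, fun e he => Eventually.of_forall fun η => ?_⟩
    · rw [Complex.norm_real, neg_div, norm_neg, Real.norm_of_nonneg (by positivity), distortion,
        div_mul_eq_mul_div, div_le_iff₀ (by positivity)]
      have : K ^ 2 ≤ L ^ 2 := by gcongr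
      nlinarith
    · refine (burkholder_le (by linarith) hl _).trans ?_
      have : 0 ≤ e * ‖η‖ ^ 2 := by positivity
      rw [hval, ← Complex.normSq_eq_norm_sq, Complex.normSq_apply,
        Complex.add_re (_ * _), Complex.re_ofReal_mul, Complex.mul_re, sq η, Complex.mul_re]
      rw [← Complex.normSq_eq_norm_sq, Complex.normSq_apply] at this
      simp only [Complex.add_re, Complex.add_im]
      linarith

theorem burkholder_nonpos {L l : ℝ} (hl : 0 ≤ l) {w : ℂ} (hw : |w.im| ≤ L * |w.re|) :
    burkholder L l w ≤ 0 := by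
  rw [burkholder]
  split_ifs with h
  · exact le_rfl
  · have := abs_nonneg w.im
    nlinarith

theorem le_burkholder {L l : ℝ} (hL : 0 ≤ L) (hl : 0 ≤ l) (w : ℂ) :
    (if l ≤ |w.im| / 2 then (|w.im| / 2) ^ 2 else 0)
      - (if l ≤ L * |w.re| + |w.im| then (L * |w.re|) ^ 2 else 0) ≤ burkholder L l w := by
  have h0 := abs_nonneg w.im
  have h1 : 0 ≤ L * |w.re| := by positivity
  rw [burkholder]
  split_ifs with h2 h3 h4 h5 h6 h7 h8 <;> nlinarith [sq_nonneg (|w.im| - l)]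

theorem integrableOn_rpow_mul_ite {p a C T : ℝ} (hp : 2 < p) :
    IntegrableOn (fun l : ℝ => l ^ (p - 3) * if l ≤ a then C else 0) (Ioc 0 T) := by
  have h1 : IntegrableOn (fun l : ℝ => l ^ (p - 3) * C) (Ioc 0 T) := by
    have := (intervalIntegral.intervalIntegrable_rpow' (a := 0) (b := T)
      (show -1 < p - 3 by linarith)).1
    exact this.mul_const C
  refine (h1.indicator (measurableSet_Iic (a := a))).congr (Eventually.of_forall fun l => ?_)
  simp [indicator_apply]

theorem integral_rpow_mul_ite {p a C T : ℝ} (hp : 2 < p) (ha : 0 ≤ a) (haT : a ≤ T) :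
    ∫ l in Ioc 0 T, (l ^ (p - 3) * if l ≤ a then C else 0) = C * a ^ (p - 2) / (p - 2) := by
  have h1 : (fun l : ℝ => l ^ (p - 3) * if l ≤ a then C else 0)
      = (Iic a).indicator fun l => l ^ (p - 3) * C := by
    ext l; simp [indicator_apply]
  rw [h1, setIntegral_indicator measurableSet_Iic, Ioc_inter_Iic, min_eq_right haT,
    ← intervalIntegral.integral_of_le ha, intervalIntegral.integral_mul_const,
    integral_rpow (Or.inl (by linarith)), zero_rpow (by linarith)]
  rw [show p - 3 + 1 = p - 2 by ring]
  ring

/-- If y ≤ 2^p x, the sum x + y is comparable to x. Otherwise x ≤ y/2^p is so small that half of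
(y/2)^p dominates. -/
theorem sq_mul_rpow_le {p x y : ℝ} (hp : 2 ≤ p) (hx : 0 ≤ x) (hy : 0 ≤ y) :
    x ^ 2 * (x + y) ^ (p - 2) ≤ 1 / 2 * (y / 2) ^ p + (1 + 2 ^ p) ^ (p - 2) * x ^ p := by
  have hp2 : 0 ≤ p - 2 := by linarith
  have hsplit : ∀ t : ℝ, 0 ≤ t → t ^ p = t ^ 2 * t ^ (p - 2) := fun t ht => by
    rw [← rpow_two, ← rpow_add' ht (by linarith)]; congr 1; ring
  have hN : (0 : ℝ) < 2 ^ p := by positivity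
  rcases le_total y (2 ^ p * x) with h | h
  · have h1 : (x + y) ^ (p - 2) ≤ ((1 + 2 ^ p) * x) ^ (p - 2) :=
      rpow_le_rpow (by positivity) (by linarith) hp2
    rw [mul_rpow (by positivity) hx] at h1
    have h2 := mul_le_mul_of_nonneg_left h1 (sq_nonneg x)
    rw [hsplit x hx]
    have : 0 ≤ 1 / 2 * (y / 2) ^ p := by positivity
    linarith
  · have h4 : (2 : ℝ) ^ p = 4 * 2 ^ (p - 2) := by rw [hsplit 2 (by norm_num)]; norm_num
    have h5 : 1 ≤ (2 : ℝ) ^ (p - 2) := one_le_rpow (by norm_num) hp2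
    have hxy : x ≤ y / 2 ^ p := by rw [le_div_iff₀ hN]; linarith
    have h6 : y / 2 ^ p ≤ y := div_le_self hy (by linarith)
    have h1 : x ^ 2 * (x + y) ^ (p - 2) ≤ (y / 2 ^ p) ^ 2 * (2 * y) ^ (p - 2) := by
      gcongr
      linarith
    have h2 : (y / 2 ^ p) ^ 2 * (2 * y) ^ (p - 2) ≤ 1 / 2 * (y / 2) ^ p := by
      rw [mul_rpow (by norm_num) hy, div_rpow hy (by norm_num), hsplit y hy, h4]
      have h7 : 0 ≤ y ^ (p - 2) := by positivity
      generalize (2 : ℝ) ^ (p - 2) = A at h5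
      generalize y ^ (p - 2) = B at h7
      have : (y / (4 * A)) ^ 2 * (A * B) = y ^ 2 * B / (16 * A) := by field_simp; ring
      rw [this, ← sub_nonneg]
      have : 1 / 2 * (y ^ 2 * B / (4 * A)) - y ^ 2 * B / (16 * A) = y ^ 2 * B / (16 * A) := by
        field_simp; ring
      rw [this]; positivity
    have : 0 ≤ (1 + 2 ^ p) ^ (p - 2) * x ^ p := by positivity
    linarith

/-- Integrating the level inequalities for Burkholder's function gives an `L^p` inequality. -/
theorem integral_abs_im_rpow_le_of_burkholder {p L : ℝ} (hp : 2 < p) (hL : 0 ≤ L) {g : ℝ → ℂ}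
    (hg : Continuous g) {b : ℝ} (hb : 0 ≤ b)
    (hle : ∀ l, 0 ≤ l → ∫ t in 0..b, burkholder L l (g t) ≤ 0) :
    ∫ t in 0..b, |(g t).im| ^ p ≤
      (2 * 2 ^ p * ((1 + 2 ^ p) ^ (p - 2) * L ^ p)) * ∫ t in 0..b, |(g t).re| ^ p := by
  obtain ⟨T, hT⟩ := (isCompact_Icc (a := 0) (b := b)).exists_bound_of_continuousOn
    (f := fun t => L * |(g t).re| + |(g t).im|) (by fun_prop)
  have hcont : Continuous fun x : ℝ × ℝ => burkholder L x.2 (g x.1) :=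
    (continuous_burkholder L).comp (f := fun x : ℝ × ℝ => (x.2, g x.1)) (by fun_prop)
  obtain ⟨D, hD⟩ := ((isCompact_Icc (a := 0) (b := b)).prod
    (isCompact_Icc (a := 0) (b := T))).exists_bound_of_continuousOn
    (f := fun x : ℝ × ℝ => burkholder L x.2 (g x.1)) hcont.continuousOn
  have hrpow : IntegrableOn (fun l : ℝ => l ^ (p - 3)) (Ioc 0 T) :=
    (intervalIntegral.intervalIntegrable_rpow' (a := 0) (b := T)
      (show -1 < p - 3 by linarith)).1
  have hint : Integrable (Function.uncurry fun t l : ℝ => l ^ (p - 3) * burkholder L l (g t))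
      ((volume.restrict (Ioc 0 b)).prod (volume.restrict (Ioc 0 T))) := by
    have h1 : Integrable (fun x : ℝ × ℝ => x.2 ^ (p - 3))
        ((volume.restrict (Ioc 0 b)).prod (volume.restrict (Ioc 0 T))) := hrpow.comp_snd _
    refine h1.mul_bdd (c := D) hcont.aestronglyMeasurable ?_
    rw [Measure.prod_restrict]
    refine (ae_restrict_iff' (measurableSet_Ioc.prod measurableSet_Ioc)).2
      (Eventually.of_forall fun x hx => hD x ?_)
    exact ⟨Ioc_subset_Icc_self hx.1, Ioc_subset_Icc_self hx.2⟩
  have hswap := integral_integral_swap hint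
  have hneg : ∫ t in Ioc 0 b, ∫ l in Ioc 0 T, l ^ (p - 3) * burkholder L l (g t) ≤ 0 := by
    rw [hswap]
    refine setIntegral_nonpos measurableSet_Ioc fun l hl => ?_
    rw [integral_const_mul, ← intervalIntegral.integral_of_le hb]
    exact mul_nonpos_of_nonneg_of_nonpos (rpow_nonneg hl.1.le _) (hle l hl.1.le)
  -- Integrating l^(p - 3) against the two indicator terms of `le_burkholder` produces (y/2)^p and
  -- x²(x + y)^(p - 2), both over p - 2; half of the former absorbs the mixed part of the latter.
  have hlower : ∀ t ∈ Ioc 0 b,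
      1 / (2 * 2 ^ p) * |(g t).im| ^ p - (1 + 2 ^ p) ^ (p - 2) * L ^ p * |(g t).re| ^ p
        ≤ (p - 2) * ∫ l in Ioc 0 T, l ^ (p - 3) * burkholder L l (g t) := by
    intro t ht
    set x := L * |(g t).re| with hx
    set y := |(g t).im| with hy
    have hx0 : 0 ≤ x := by positivity
    have hy0 : 0 ≤ y := abs_nonneg _
    have hxyT : x + y ≤ T := (le_abs_self _).trans (hT t (Ioc_subset_Icc_self ht))
    have hI : IntegrableOn (fun l : ℝ => l ^ (p - 3) * burkholder L l (g t)) (Ioc 0 T) := by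
      refine hrpow.mul_bdd (c := D)
        (hcont.comp (f := fun l : ℝ => (t, l)) (by fun_prop)).aestronglyMeasurable ?_
      refine (ae_restrict_iff' measurableSet_Ioc).2 (Eventually.of_forall fun l hl => ?_)
      exact hD (t, l) ⟨Ioc_subset_Icc_self ht, Ioc_subset_Icc_self hl⟩
    have h1 := setIntegral_mono_on
      ((integrableOn_rpow_mul_ite (a := y / 2) (C := (y / 2) ^ 2) (T := T) hp).sub
        (integrableOn_rpow_mul_ite (a := x + y) (C := x ^ 2) (T := T) hp)) hI measurableSet_Ioc
      fun l hl => by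
        have := mul_le_mul_of_nonneg_left (le_burkholder hL hl.1.le (g t))
          (rpow_nonneg hl.1.le (p - 3))
        rw [mul_sub] at this
        exact this
    simp only [Pi.sub_apply] at h1
    rw [integral_sub (integrableOn_rpow_mul_ite hp) (integrableOn_rpow_mul_ite hp),
      integral_rpow_mul_ite hp (by positivity) (by linarith),
      integral_rpow_mul_ite hp (by positivity) hxyT] at h1
    have hp2 : 0 < p - 2 := by linarith
    have h2 := mul_le_mul_of_nonneg_left h1 hp2.le
    have h3 : (p - 2) * ((y / 2) ^ 2 * (y / 2) ^ (p - 2) / (p - 2)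
        - x ^ 2 * (x + y) ^ (p - 2) / (p - 2))
        = (y / 2) ^ p - x ^ 2 * (x + y) ^ (p - 2) := by
      have : (y / 2) ^ p = (y / 2) ^ 2 * (y / 2) ^ (p - 2) := by
        rw [← rpow_two, ← rpow_add' (by positivity) (by linarith)]; congr 1; ring
      rw [this]; field_simp
    rw [h3] at h2
    have h4 := sq_mul_rpow_le hp.le hx0 hy0
    have h5 : (y / 2) ^ p = y ^ p / 2 ^ p := div_rpow hy0 (by norm_num) _
    have h6 : x ^ p = L ^ p * |(g t).re| ^ p := mul_rpow hL (abs_nonneg _)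
    have h7 : 1 / (2 * 2 ^ p) * y ^ p = 1 / 2 * (y ^ p / 2 ^ p) := by field_simp
    rw [h6] at h4
    rw [h5] at h2 h4
    rw [h7]
    linarith
  have hre : Continuous fun t => |(g t).re| ^ p :=
    Continuous.rpow_const (by fun_prop) fun _ => Or.inr (by linarith)
  have him : Continuous fun t => |(g t).im| ^ p :=
    Continuous.rpow_const (by fun_prop) fun _ => Or.inr (by linarith)
  have hJ := setIntegral_mono_on
    (Continuous.integrableOn_Ioc (by fun_prop)) (hint.integral_prod_left.const_mul (p - 2))
    measurableSet_Ioc hlower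
  rw [integral_const_mul, ← intervalIntegral.integral_of_le hb, intervalIntegral.integral_sub
    ((him.intervalIntegrable _ _).const_mul _) ((hre.intervalIntegrable _ _).const_mul _),
    intervalIntegral.integral_const_mul, intervalIntegral.integral_const_mul] at hJ
  have h8 := mul_nonpos_of_nonneg_of_nonpos (show 0 ≤ p - 2 by linarith) hneg
  have h9 := hJ.trans h8
  have hN : (0 : ℝ) < 2 * 2 ^ p := by positivity
  rw [sub_nonpos, one_div, inv_mul_le_iff₀ hN] at h9
  linarith

/-- Norm inequality with a nonsharp constant, for arbitrary distortion. -/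
theorem exists_circleAverage_abs_im_rpow_le {K L p : ℝ} (hK : 1 ≤ K) (hKL : K ≤ L) (hp : 2 ≤ p) :
    ∃ M : ℝ, 0 ≤ M ∧ ∀ f : ℂ → ℂ, IsHarmonicQuasiregular K unitDisk f →
      |(f 0).im| ≤ L * |(f 0).re| → ∀ r ∈ Ico (0 : ℝ) 1,
        circleAverage (fun z => |(f z).im| ^ p) 0 r ≤
          M * circleAverage (fun z => |(f z).re| ^ p) 0 r := by
  have hL : 0 ≤ L := by linarith
  have hpi := two_pi_pos
  have hle : ∀ f : ℂ → ℂ, IsHarmonicQuasiregular K unitDisk f →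
      |(f 0).im| ≤ L * |(f 0).re| → ∀ r ∈ Ico (0 : ℝ) 1, ∀ l, 0 ≤ l →
        ∫ t in 0..2 * π, burkholder L l (f (circleMap 0 r t)) ≤ 0 := by
    intro f hf h0 r hr l hl
    have h1 := (hf.circleAverage_comp_le
      ((continuous_burkholder L).comp (f := fun w => (l, w)) (by fun_prop))
      (fun w => hasSuperjet_burkholder hK hKL hl w) hr).trans (burkholder_nonpos hl h0)
    rw [circleAverage, smul_eq_mul] at h1
    by_contra hcon
    have : 0 < (2 * π)⁻¹ * ∫ t in 0..2 * π, burkholder L l (f (circleMap 0 r t)) :=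
      mul_pos (by positivity) (not_le.1 hcon)
    exact absurd h1 (not_le.2 this)
  have hgc : ∀ f : ℂ → ℂ, IsHarmonicQuasiregular K unitDisk f → ∀ r ∈ Ico (0 : ℝ) 1,
      Continuous fun t => f (circleMap 0 r t) := by
    intro f hf r hr
    refine hf.1.continuousOn.comp_continuous (continuous_circleMap 0 r) fun t => ?_
    simpa [unitDisk, abs_of_nonneg hr.1] using hr.2
  rcases hp.eq_or_lt with rfl | hp2
  -- For p = 2 the weight l^(p - 3) is not integrable at 0, but the level l = 0 alone gives the
  -- claim.
  · refine ⟨L ^ 2, by positivity, fun f hf h0 r hr => ?_⟩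
    have h1 := hle f hf h0 r hr 0 le_rfl
    have h2 : ∀ w : ℂ, burkholder L 0 w = |w.im| ^ (2 : ℝ) - L ^ 2 * |w.re| ^ (2 : ℝ) := by
      intro w
      rw [burkholder, rpow_two, rpow_two]
      split_ifs with h
      · have h3 := abs_nonneg w.im
        have h4 : 0 ≤ L * |w.re| := by positivity
        have h5 : |w.im| = 0 := by linarith
        have h6 : L * |w.re| = 0 := by linarith
        rw [← mul_pow, h5, h6]; norm_num
      · ring
    have hc := hgc f hf r hr
    have hre : Continuous fun t => |(f (circleMap 0 r t)).re| ^ (2 : ℝ) :=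
      (Complex.continuous_re.comp hc).abs.rpow_const fun _ => Or.inr (by norm_num)
    have him : Continuous fun t => |(f (circleMap 0 r t)).im| ^ (2 : ℝ) :=
      (Complex.continuous_im.comp hc).abs.rpow_const fun _ => Or.inr (by norm_num)
    simp only [h2] at h1
    rw [intervalIntegral.integral_sub (him.intervalIntegrable _ _)
      ((hre.intervalIntegrable _ _).const_mul _), intervalIntegral.integral_const_mul,
      sub_nonpos] at h1
    rw [circleAverage, circleAverage, smul_eq_mul, smul_eq_mul, mul_left_comm]
    gcongr
  · refine ⟨2 * 2 ^ p * ((1 + 2 ^ p) ^ (p - 2) * L ^ p), by positivity, fun f hf h0 r hr => ?_⟩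
    have h1 := integral_abs_im_rpow_le_of_burkholder hp2 hL (hgc f hf r hr) hpi.le
      (hle f hf h0 r hr)
    rw [circleAverage, circleAverage, smul_eq_mul, smul_eq_mul, mul_left_comm]
    gcongr

end HarmonicQR

end

/-! ### The condition at the centre, the constants and their limits, and Hardy norms. -/

noncomputable section

namespace HarmonicQR

open InnerProductSpace

/-- Let t be the signed angle from the positive imaginary axis. If |t| ≤ π/2 the angle to the axis
is |t| and the cosine condition applies directly. Otherwise it is π - |t|: for even p the cosine is
unchanged under this reflection, and the sector says exactly |t| ≤ π - π/(2p). -/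
theorem pi_div_le_axisAngle {p : ℝ} (hp : 2 ≤ p) {w : ℂ}
    (hcos : cos (p * (argBranch w - π / 2)) ≤ 0) (hpw : IsEvenInteger p ∨ w ∈ sectorD p) :
    π / (2 * p) ≤ axisAngle w := by
  have hp0 : 0 < p := by linarith
  have hpi := pi_pos
  by_contra! hcon
  set t := Complex.arg (-Complex.I * w) with ht
  have hbr : argBranch w = π / 2 + t := rfl
  rw [hbr, add_sub_cancel_left] at hcos
  have hpos : ∀ x : ℝ, 0 ≤ x → x < π / (2 * p) → 0 < cos (p * x) := fun x h0 hx => by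
    have h1 : p * x < π / 2 := by
      rw [lt_div_iff₀ (by positivity)] at hx
      linarith
    exact cos_pos_of_mem_Ioo ⟨by nlinarith, h1⟩
  have hang : axisAngle w = arcsin |sin t| := by
    rw [axisAngle, ht, Complex.sin_arg]
    simp [abs_div]
  rw [hang] at hcon
  have htpi : |t| ≤ π := Complex.abs_arg_le_pi _
  have hcabs : cos (p * t) = cos (p * |t|) := by
    rw [← cos_abs, abs_mul, abs_of_pos hp0]
  rw [hcabs] at hcos
  rcases le_total |t| (π / 2) with h | h
  · rw [arcsin_abs_sin h] at hcon
    exact absurd hcos (not_le.2 (hpos _ (abs_nonneg t) hcon))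
  · have h1 : |π - (|t|)| = π - |t| := abs_of_nonneg (by linarith)
    have h2 : |sin t| = |sin (π - (|t|))| := by
      rw [sin_pi_sub]; rcases abs_choice t with h | h <;> simp [h]
    rw [h2, arcsin_abs_sin (by rw [h1]; linarith), h1] at hcon
    rcases hpw with ⟨n, ⟨m, hm⟩, hn⟩ | hsec
    · have h3 : cos (p * |t|) = cos (p * (π - |t|)) := by
        have h4 : p * |t| = m * (2 * π) - p * (π - |t|) := by
          rw [hn, hm]; push_cast; ring
        rw [h4, cos_int_mul_two_pi_sub]
      rw [h3] at hcos
      exact absurd hcos (not_le.2 (hpos _ (by linarith) hcon))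
    · obtain ⟨hs1, hs2⟩ := hsec
      rw [hbr] at hs1 hs2
      have e1 : (p - 1) * π / (2 * p) = π / 2 - π / (2 * p) := by field_simp
      have e2 : (3 * p - 1) * π / (2 * p) = 3 * π / 2 - π / (2 * p) := by field_simp
      rw [e1] at hs1
      rw [e2] at hs2
      have : |t| ≤ π - π / (2 * p) := abs_le.2 ⟨by linarith, by linarith⟩
      linarith

theorem sharpFun_nonpos {p : ℝ} (hp : 2 ≤ p) {w : ℂ} (h : π / (2 * p) ≤ axisAngle w) :
    sharpFun p w ≤ 0 := by
  have hp0 : 0 < p := by linarith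
  have hpi := pi_pos
  refine mul_nonpos_of_nonneg_of_nonpos (by positivity) (cos_nonpos_of_pi_div_two_le_of_le ?_ ?_)
  · have h1 : π / (2 * p) ≤ min (axisAngle w) (π / p) :=
      le_min h (by gcongr; linarith)
    calc π / 2 = p * (π / (2 * p)) := by field_simp
      _ ≤ _ := by gcongr
  · calc _ ≤ p * (π / p) := by gcongr; exact min_le_right _ _
      _ = π := by field_simp
      _ ≤ π + π / 2 := by linarith

theorem abs_im_le_of_le_axisAngle {a : ℝ} (ha : 0 < a) {w : ℂ} (h : a ≤ axisAngle w) :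
    |w.im| ≤ cos a / sin a * |w.re| := by
  have h1 := axisAngle_le w
  have hS : 0 < sin a := sin_pos_of_pos_of_lt_pi ha (by linarith [pi_pos])
  have h2 : cos (axisAngle w) ≤ cos a :=
    cos_le_cos_of_nonneg_of_le_pi ha.le (by linarith [pi_pos]) h
  have h3 : sin a ≤ sin (axisAngle w) :=
    sin_le_sin_of_le_of_le_pi_div_two (by linarith [pi_pos]) h1 h
  rw [← norm_mul_cos_axisAngle, ← norm_mul_sin_axisAngle, div_mul_eq_mul_div, le_div_iff₀ hS]
  have h4 : 0 ≤ cos a := (cos_axisAngle_nonneg w).trans h2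
  calc ‖w‖ * cos (axisAngle w) * sin a ≤ ‖w‖ * cos a * sin (axisAngle w) := by gcongr
    _ = _ := by ring

theorem IsHarmonicQuasiregular.circleIntegrable_comp {K : ℝ} {f : ℂ → ℂ}
    (hf : IsHarmonicQuasiregular K unitDisk f) {Ψ : ℂ → ℝ} (hΨ : Continuous Ψ) {r : ℝ}
    (hr : r ∈ Ico (0 : ℝ) 1) : CircleIntegrable (fun z => Ψ (f z)) 0 r := by
  refine ContinuousOn.circleIntegrable hr.1 (hΨ.comp_continuousOn (hf.1.continuousOn.mono ?_))
  exact Metric.sphere_subset_closedBall.trans (Metric.closedBall_subset_ball hr.2)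

/-- Averaging a pointwise inequality over a circle. -/
theorem IsHarmonicQuasiregular.circleAverage_le_add {K : ℝ} {f : ℂ → ℂ}
    (hf : IsHarmonicQuasiregular K unitDisk f) {Ψ Ψ₁ Ψ₂ : ℂ → ℝ} (hΨ : Continuous Ψ)
    (hΨ₁ : Continuous Ψ₁) (hΨ₂ : Continuous Ψ₂) {a b : ℝ} (hle : ∀ w, Ψ w ≤ a * Ψ₁ w + b * Ψ₂ w)
    {r : ℝ} (hr : r ∈ Ico (0 : ℝ) 1) :
    circleAverage (fun z => Ψ (f z)) 0 r ≤ a * circleAverage (fun z => Ψ₁ (f z)) 0 r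
      + b * circleAverage (fun z => Ψ₂ (f z)) 0 r := by
  have h1 := hf.circleIntegrable_comp (Ψ := fun w => a * Ψ₁ w) (by fun_prop) hr
  have h2 := hf.circleIntegrable_comp (Ψ := fun w => b * Ψ₂ w) (by fun_prop) hr
  have h3 := circleAverage_mono (hf.circleIntegrable_comp hΨ hr) (h1.add h2) fun z _ => hle (f z)
  rw [circleAverage_add h1 h2] at h3
  simpa only [← smul_eq_mul, circleAverage_fun_smul] using h3

/-- The factor `p`-th power bound for `f` at small distortion. -/
def sharpNormFactor (K p : ℝ) : ℝ :=
  (1 / sin (π / (2 * p))) ^ p /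
    (1 - cos (π / (2 * p)) / sin (π / (2 * p)) * ((p - 1) * distortion K))

/-- The factor in the `p`-th power bound for the imaginary part at small distortion. -/
def sharpImFactor (K p : ℝ) : ℝ :=
  (cos (π / (2 * p)) / sin (π / (2 * p))) ^ p +
    cos (π / (2 * p)) ^ (p - 1) / sin (π / (2 * p)) *
      ((p - 1) * distortion K * sharpNormFactor K p)

theorem sin_cos_pos_of_two_le {p : ℝ} (hp : 2 ≤ p) :
    0 < π / (2 * p) ∧ 0 < sin (π / (2 * p)) ∧ 0 < cos (π / (2 * p)) := by
  have hpi := pi_pos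
  have h3 : π / (2 * p) < π / 2 := by gcongr; linarith
  have h4 : 0 < π / (2 * p) := by positivity
  exact ⟨h4, sin_pos_of_pos_of_lt_pi h4 (by linarith), cos_pos_of_mem_Ioo ⟨by linarith, h3⟩⟩

theorem circleAverage_rpow_nonneg {F : Type*} [NormedAddCommGroup F] (g : ℂ → F) (p r : ℝ) :
    0 ≤ circleAverage (fun z => ‖g z‖ ^ p) 0 r := by
  rw [circleAverage, smul_eq_mul]
  have hpi := two_pi_pos
  have := intervalIntegral.integral_nonneg (μ := volume) hpi.le
    (f := fun t => ‖g (circleMap 0 r t)‖ ^ p) fun t _ => by positivity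
  positivity

theorem circleAverage_sharp_le {K p : ℝ} (hK : 1 ≤ K) (hp : 2 ≤ p)
    (hsmall : cos (π / (2 * p)) / sin (π / (2 * p)) * ((p - 1) * distortion K) < 1) {f : ℂ → ℂ}
    (hf : IsHarmonicQuasiregular K unitDisk f) (h0 : sharpFun p (f 0) ≤ 0) {r : ℝ}
    (hr : r ∈ Ico (0 : ℝ) 1) :
    circleAverage (fun z => ‖f z‖ ^ p) 0 r ≤
        sharpNormFactor K p * circleAverage (fun z => |(f z).re| ^ p) 0 r ∧
      circleAverage (fun z => |(f z).im| ^ p) 0 r ≤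
        sharpImFactor K p * circleAverage (fun z => |(f z).re| ^ p) 0 r := by
  have hp0 : 0 < p := by linarith
  obtain ⟨ha, hS, hC⟩ := sin_cos_pos_of_two_le hp
  have hκ := distortion_nonneg hK
  have hε : 0 ≤ (p - 1) * distortion K := mul_nonneg (by linarith) hκ
  have cn : Continuous fun w : ℂ => ‖w‖ ^ p := continuous_norm.rpow_const fun _ => Or.inr hp0.le
  have cr : Continuous fun w : ℂ => |w.re| ^ p :=
    Complex.continuous_re.abs.rpow_const fun _ => Or.inr hp0.le
  have ci : Continuous fun w : ℂ => |w.im| ^ p :=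
    Complex.continuous_im.abs.rpow_const fun _ => Or.inr hp0.le
  have cs := continuous_sharpFun hp0
  have h1 := hf.circleAverage_le_add cn cr cs (norm_rpow_le hp) hr
  have h2 := hf.circleAverage_le_add ci cr cs (abs_im_rpow_le hp) hr
  have h3 := (hf.circleAverage_comp_le (Ψ := fun w => sharpFun p w - (p - 1) * distortion K * ‖w‖ ^ p)
    (by fun_prop) (hasSuperjet_sharpFun hp hκ) hr).trans (show _ ≤ (0 : ℝ) by
      have : 0 ≤ (p - 1) * distortion K * ‖f 0‖ ^ p := by positivity
      linarith)
  have h4 := hf.circleAverage_le_add (Ψ := sharpFun p)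
    (Ψ₁ := fun w => sharpFun p w - (p - 1) * distortion K * ‖w‖ ^ p) (Ψ₂ := fun w => ‖w‖ ^ p)
    (a := 1) (b := (p - 1) * distortion K) cs (by fun_prop) cn (fun w => by linarith) hr
  have hu := circleAverage_rpow_nonneg (fun z => (f z).re) p r
  simp only [Real.norm_eq_abs] at hu
  set A := circleAverage (fun z => ‖f z‖ ^ p) 0 r
  set U := circleAverage (fun z => |(f z).re| ^ p) 0 r
  set P := circleAverage (fun z => sharpFun p (f z)) 0 r
  set ε := (p - 1) * distortion K with hε_def
  have h5 : P ≤ ε * A := by linarith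
  have h6 : A ≤ sharpNormFactor K p * U := by
    -- Absorption: A ≤ csc^p U + cot · εA is solved for A, the smallness assumption making the
    -- denominator positive.
    rw [sharpNormFactor, ← hε_def, div_mul_eq_mul_div, le_div_iff₀ (by linarith)]
    have : cos (π / (2 * p)) / sin (π / (2 * p)) * P
        ≤ cos (π / (2 * p)) / sin (π / (2 * p)) * (ε * A) := by gcongr
    linarith
  refine ⟨h6, h2.trans ?_⟩
  have h7 : P ≤ ε * sharpNormFactor K p * U := by
    rw [mul_assoc]
    exact h5.trans (by gcongr)
  rw [sharpImFactor, ← hε_def, add_mul, mul_assoc (_ / _) _ U]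
  gcongr

theorem norm_rpow_le_two_rpow_mul {p : ℝ} (hp : 0 ≤ p) (w : ℂ) :
    ‖w‖ ^ p ≤ 2 ^ p * |w.re| ^ p + 2 ^ p * |w.im| ^ p := by
  have h1 := Complex.norm_le_abs_re_add_abs_im w
  have h2 := abs_nonneg w.re
  have h3 := abs_nonneg w.im
  have h4 : 0 ≤ 2 ^ p * |w.re| ^ p := by positivity
  have h5 : 0 ≤ 2 ^ p * |w.im| ^ p := by positivity
  rcases le_total |w.re| |w.im| with h | h
  · have : ‖w‖ ^ p ≤ (2 * |w.im|) ^ p := rpow_le_rpow (norm_nonneg w) (by linarith) hp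
    rw [mul_rpow (by norm_num) h3] at this
    linarith
  · have : ‖w‖ ^ p ≤ (2 * |w.re|) ^ p := rpow_le_rpow (norm_nonneg w) (by linarith) hp
    rw [mul_rpow (by norm_num) h2] at this
    linarith

/-- The bounds on integral means, with sharp factors at small distortion. -/
theorem exists_circleAverage_bounds (K p : ℝ) : ∃ A B : ℝ, 1 ≤ K → 2 ≤ p →
    (cos (π / (2 * p)) / sin (π / (2 * p)) * ((p - 1) * distortion K) < 1 →
      A = sharpNormFactor K p ∧ B = sharpImFactor K p) ∧ 0 ≤ A ∧ 0 ≤ B ∧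
    ∀ f : ℂ → ℂ, IsHarmonicQuasiregular K unitDisk f →
      f 0 = 0 ∨ π / (2 * p) ≤ axisAngle (f 0) → ∀ r ∈ Ico (0 : ℝ) 1,
        circleAverage (fun z => ‖f z‖ ^ p) 0 r ≤
          A * circleAverage (fun z => |(f z).re| ^ p) 0 r ∧
        circleAverage (fun z => |(f z).im| ^ p) 0 r ≤
          B * circleAverage (fun z => |(f z).re| ^ p) 0 r := by
  by_cases hKp : 1 ≤ K ∧ 2 ≤ p
  swap
  · exact ⟨0, 0, fun hK hp => absurd ⟨hK, hp⟩ hKp⟩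
  obtain ⟨hK, hp⟩ := hKp
  have hp0 : 0 < p := by linarith
  obtain ⟨ha, hS, hC⟩ := sin_cos_pos_of_two_le hp
  have hκ := distortion_nonneg hK
  have hp1 : 0 ≤ p - 1 := by linarith
  by_cases hsmall : cos (π / (2 * p)) / sin (π / (2 * p)) * ((p - 1) * distortion K) < 1
  · have hA : 0 ≤ sharpNormFactor K p := div_nonneg (by positivity) (by linarith)
    refine ⟨sharpNormFactor K p, sharpImFactor K p, fun _ _ => ⟨fun _ => ⟨rfl, rfl⟩, hA, ?_,
      fun f hf h0 r hr => circleAverage_sharp_le hK hp hsmall hf ?_ hr⟩⟩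
    · rw [sharpImFactor]
      positivity
    · rcases h0 with h0 | h0
      · simp [h0, sharpFun, hp0.ne']
      · exact sharpFun_nonpos hp h0
  -- The parameter L = max(K, cot(π/(2p))) meets both requirements: K ≤ L, and the centre lies in
  -- the cone |v| ≤ L|u|.
  · obtain ⟨M, hM, hbound⟩ := exists_circleAverage_abs_im_rpow_le (p := p) hK
      (le_max_left K (cos (π / (2 * p)) / sin (π / (2 * p)))) hp
    refine ⟨2 ^ p + 2 ^ p * M, M, fun _ _ => ⟨fun h => absurd h hsmall, by positivity, hM,
      fun f hf h0 r hr => ?_⟩⟩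
    have hcenter : |(f 0).im| ≤ max K (cos (π / (2 * p)) / sin (π / (2 * p))) * |(f 0).re| := by
      rcases h0 with h0 | h0
      · simp [h0]
      · refine (abs_im_le_of_le_axisAngle ha h0).trans ?_
        gcongr
        exact le_max_right _ _
    have h1 := hbound f hf hcenter r hr
    have h2 := hf.circleAverage_le_add (Ψ := fun w => ‖w‖ ^ p) (Ψ₁ := fun w => |w.re| ^ p)
      (Ψ₂ := fun w => |w.im| ^ p) (continuous_norm.rpow_const fun _ => Or.inr hp0.le)
      (Complex.continuous_re.abs.rpow_const fun _ => Or.inr hp0.le)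
      (Complex.continuous_im.abs.rpow_const fun _ => Or.inr hp0.le)
      (norm_rpow_le_two_rpow_mul hp0.le) hr
    refine ⟨h2.trans ?_, h1⟩
    rw [add_mul, mul_assoc (2 ^ p) M]
    gcongr

theorem tendsto_distortion : Tendsto distortion (𝓝[>] 1) (𝓝 0) := by
  have h : ContinuousAt distortion 1 := by
    unfold distortion
    exact ContinuousAt.div (by fun_prop) (by fun_prop) (by norm_num)
  have h1 : distortion 1 = 0 := by norm_num [distortion]
  have := h.tendsto.mono_left (nhdsWithin_le_nhds (s := Ioi 1))
  rwa [h1] at this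

theorem tendsto_sharpNormFactor (p : ℝ) :
    Tendsto (fun K => sharpNormFactor K p) (𝓝[>] 1) (𝓝 ((1 / sin (π / (2 * p))) ^ p)) := by
  have h1 := ((tendsto_distortion.const_mul (p - 1)).const_mul
    (cos (π / (2 * p)) / sin (π / (2 * p)))).const_sub 1
  have h2 := (tendsto_const_nhds (x := (1 / sin (π / (2 * p))) ^ p)).div h1 (by simp)
  rw [mul_zero, mul_zero, sub_zero, div_one] at h2
  exact h2

theorem tendsto_sharpImFactor (p : ℝ) : Tendsto (fun K => sharpImFactor K p) (𝓝[>] 1)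
    (𝓝 ((cos (π / (2 * p)) / sin (π / (2 * p))) ^ p)) := by
  have h1 := (((tendsto_distortion.const_mul (p - 1)).mul (tendsto_sharpNormFactor p)).const_mul
    (cos (π / (2 * p)) ^ (p - 1) / sin (π / (2 * p)))).const_add
      ((cos (π / (2 * p)) / sin (π / (2 * p))) ^ p)
  simpa [sharpImFactor] using h1

/-- Comparison of Hardy norms from a comparison of `p`-th powers of integral means. -/
theorem memHarmonicHardy_and_hardyNorm_le {F G : Type*} [NormedAddCommGroup F] [NormedSpace ℝ F]
    [NormedAddCommGroup G] [NormedSpace ℝ G] {p M : ℝ} (hp : 0 < p) (hM : 0 ≤ M) {g : ℂ → F}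
    {u : ℂ → G} (hg : HarmonicOnNhd g unitDisk) (hu : MemHarmonicHardy p u)
    (h : ∀ r ∈ Ico (0 : ℝ) 1, circleAverage (fun z => ‖g z‖ ^ p) 0 r ≤
      M * circleAverage (fun z => ‖u z‖ ^ p) 0 r) :
    MemHarmonicHardy p g ∧ hardyNorm p g ≤ M ^ (1 / p) * hardyNorm p u := by
  have hle : ∀ r : Ico (0 : ℝ) 1, integralMean p r g ≤ M ^ (1 / p) * hardyNorm p u := by
    intro r
    have h1 : integralMean p r g ≤ M ^ (1 / p) * integralMean p r u := by
      rw [integralMean, integralMean, ← mul_rpow hM (circleAverage_rpow_nonneg u p r)]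
      exact rpow_le_rpow (circleAverage_rpow_nonneg g p r) (h r r.2) (by positivity)
    refine h1.trans ?_
    gcongr
    exact le_ciSup hu.2 r
  have : Nonempty (Ico (0 : ℝ) 1) := ⟨⟨0, by norm_num⟩⟩
  exact ⟨⟨hg, _, forall_mem_range.2 hle⟩, ciSup_le hle⟩

end HarmonicQR

end

theorem mainTheorem2 :
    ∃ C c : ℝ → ℝ → ℝ, ∀ p : ℝ, 2 ≤ p →
      Tendsto (fun K => C K p) (𝓝[>] 1) (𝓝 (1 / Real.sin (π / (2 * p)))) ∧
      Tendsto (fun K => c K p) (𝓝[>] 1) (𝓝 (Real.cot (π / (2 * p)))) ∧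
      ∀ K : ℝ, 1 ≤ K → ∀ f : ℂ → ℂ,
        HarmonicQR.IsHarmonicQuasiregular K HarmonicQR.unitDisk f →
        HarmonicQR.MemHarmonicHardy p (fun z => (f z).re) →
        (f 0 = 0 ∨ Real.cos (p * (HarmonicQR.argBranch (f 0) - π / 2)) ≤ 0) →
        (HarmonicQR.IsEvenInteger p ∨
          (¬ HarmonicQR.IsEvenInteger p ∧
            f '' HarmonicQR.unitDisk ⊆ HarmonicQR.sectorD p)) →
        (HarmonicQR.MemHarmonicHardy p f ∧
          HarmonicQR.hardyNorm p f ≤ C K p * HarmonicQR.hardyNorm p (fun z => (f z).re)) ∧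
        (HarmonicQR.MemHarmonicHardy p (fun z => (f z).im) ∧
          HarmonicQR.hardyNorm p (fun z => (f z).im) ≤
            c K p * HarmonicQR.hardyNorm p (fun z => (f z).re)) := by
  choose A B hAB using HarmonicQR.exists_circleAverage_bounds
  refine ⟨fun K p => A K p ^ (1 / p), fun K p => B K p ^ (1 / p), fun p hp => ?_⟩
  have hp0 : 0 < p := by linarith
  obtain ⟨ha, hS, hC⟩ := HarmonicQR.sin_cos_pos_of_two_le hp
  -- Only K near 1 matters for the limits, and there the small-distortion factors are in force.
  have hev : ∀ᶠ K in 𝓝[>] (1 : ℝ),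
      A K p = HarmonicQR.sharpNormFactor K p ∧ B K p = HarmonicQR.sharpImFactor K p := by
    have h1 := (HarmonicQR.tendsto_distortion.const_mul (p - 1)).const_mul
      (cos (π / (2 * p)) / sin (π / (2 * p)))
    rw [mul_zero, mul_zero] at h1
    filter_upwards [h1.eventually (gt_mem_nhds one_pos), self_mem_nhdsWithin] with K h2 hK
    exact (hAB K p (le_of_lt hK) hp).1 h2
  refine ⟨?_, ?_, fun K hK f hf hu h0 hpw => ?_⟩
  · have h1 := (HarmonicQR.tendsto_sharpNormFactor p).rpow_const (p := 1 / p)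
      (Or.inr (by positivity))
    rw [← Real.rpow_mul (by positivity), mul_one_div_cancel hp0.ne', Real.rpow_one] at h1
    exact h1.congr' (hev.mono fun K h => by simp only [h.1])
  · have h1 := (HarmonicQR.tendsto_sharpImFactor p).rpow_const (p := 1 / p)
      (Or.inr (by positivity))
    rw [← Real.rpow_mul (by positivity), mul_one_div_cancel hp0.ne', Real.rpow_one,
      ← Real.cot_eq_cos_div_sin] at h1
    exact h1.congr' (hev.mono fun K h => by simp only [h.2])
  · obtain ⟨-, hA, hB, hbound⟩ := hAB K p hK hp
    have hcenter : f 0 = 0 ∨ π / (2 * p) ≤ HarmonicQR.axisAngle (f 0) := by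
      rcases eq_or_ne (f 0) 0 with hz | hz
      · exact Or.inl hz
      · refine Or.inr (HarmonicQR.pi_div_le_axisAngle hp (h0.resolve_left hz) ?_)
        exact hpw.imp_right fun h => h.2 ⟨0, Metric.mem_ball_self one_pos, rfl⟩
    have h := hbound f hf hcenter
    exact ⟨HarmonicQR.memHarmonicHardy_and_hardyNorm_le hp0 hA hf.1 hu fun r hr => (h r hr).1,
      HarmonicQR.memHarmonicHardy_and_hardyNorm_le hp0 hB
        (hf.1.comp_CLM Complex.imCLM) hu fun r hr => (h r hr).2⟩
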